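/- Let $1<p<\infty$ and let $(T_n)_{n}$ be a sequence of (not necessarily linear) operators $T_n:L_p([0,1])\to L_p([0,1])$ which are - sublinear: $T_n(f+g)\le T_n(f)+T_n(g)$ and $T_n(\alpha f)=\alpha T_n(f)$ for all $f,g\in L_p([0,1])$ and $\alpha\ge 0$; - monotone: $f\le g$ implies $T_n(f)\le T_n(g)$; - strongly translatable: $T_n(f+\alpha\cdot 1)=T_n(f)+\alpha T_n(1)$ for all $f\in L_p([0,1])$ and $\alpha\in\mathbb{R}$; (inequalities being almost everywhere), and uniformly bounded: there is $R$ with $\|T_n(f)\|_p\le R\|f\|_p$ for all $n$ and all $f\in L_p([0,1])$. Write $e_k(t)=t^k$. For $g_x=|e_1-x|$ or $g_x=(e_1-x)^2$, $x\in[0,1]$, let $T_n(g_x)(x)$ denote the function of $x\in[0,1]$ obtained by evaluating at $x$ the function $T_n(g_x)$; precisely, its value at $x$ is $\lim_{q\to x,\ q\in\mathbb{Q}\cap[0,1]}T_n(g_q)(x)$, a limit that exists for almost every $x$ and does not depend, up to a null set, on the choice of representatives. Put $$t_{n,p}=\left(\max\left\{\|T_n(e_0)-e_0\|_p,\ \|T_n(|e_1-x|)(x)\|_p,\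 \|T_n((e_1-x)^2)(x)\|_\infty\right\}\right)^{1/2}\in[0,\infty].$$ For $f\in L_p([0,1])$ and $\delta\in[0,\infty]$ let $$\omega_{2,p}(f;\delta)=\sup_{h\in\mathbb{R},\ |h|\le\delta}\|f(\cdot+2h)-2f(\cdot+h)+f(\cdot)\|_{p},$$ where the norm is taken over those $x\in[0,1]$ with $x+2h\in[0,1]$. If $\lim_{n\to\infty}t_{n,p}=0$, then there is a constant $M_p>0$, independent of $f$ and $n$, such that for all $n$ and all $f\in L_p([0,1])$ $$\|T_n(f)-f\|_p\le M_p\left[t_{n,p}^2\|f\|_p+\omega_{2,p}(f;t_{n,p})\right]$$ (with the convention $\infty\cdot 0=0$ on the right-hand side). -/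

import Mathlib

open MeasureTheory Filter Topology Set
open scoped ENNReal NNReal

/-- Lebesgue measure on `[0,1]`, as a measure on `ℝ`. -/
noncomputable abbrev leb01 : Measure ℝ := volume.restrict (Icc (0 : ℝ) 1)

/-- The space `L_p([0,1])`, with the almost everywhere order. -/
noncomputable abbrev Lp01 (p : ℝ≥0∞) := Lp ℝ p leb01

/-- Subadditivity and positive homogeneity. -/
def IsSublinearOp {p : ℝ≥0∞} (T : Lp01 p → Lp01 p) : Prop :=
  (∀ f g : Lp01 p, T (f + g) ≤ T f + T g) ∧
    ∀ (a : ℝ) (f : Lp01 p), 0 ≤ a → T (a • f) = a • T f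

theorem memLp_of_continuous01 (p : ℝ≥0∞) {u : ℝ → ℝ} (hu : Continuous u) :
    MemLp u p leb01 := by
  obtain ⟨C, hC⟩ := (isCompact_Icc (a := (0 : ℝ)) (b := 1)).exists_bound_of_continuousOn
    hu.continuousOn
  refine MemLp.of_bound hu.aestronglyMeasurable C ?_
  exact (ae_restrict_iff' measurableSet_Icc).2 (Eventually.of_forall hC)

/-- The class in `L_p([0,1])` of a continuous function. -/
noncomputable def contLp (p : ℝ≥0∞) (u : ℝ → ℝ) (hu : Continuous u) : Lp01 p :=
  (memLp_of_continuous01 p hu).toLp u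

/-- The constant function `e₀ = 1`. -/
noncomputable def eZero (p : ℝ≥0∞) : Lp01 p := contLp p (fun _ => 1) continuous_const

/-- The function `|e₁ - x| : t ↦ |t - x|`, for a fixed `x`. -/
noncomputable def absShift (p : ℝ≥0∞) (x : ℝ) : Lp01 p :=
  contLp p (fun t => |t - x|) (by fun_prop)

/-- The function `(e₁ - x)² : t ↦ (t - x)²`, for a fixed `x`. -/
noncomputable def sqShift (p : ℝ≥0∞) (x : ℝ) : Lp01 p :=
  contLp p (fun t => (t - x) ^ 2) (by fun_prop)

/-- Strong translatability: `T (f + a · 1) = T f + a T 1` for all real `a`. -/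
def IsStronglyTranslatable {p : ℝ≥0∞} (T : Lp01 p → Lp01 p) : Prop :=
  ∀ (f : Lp01 p) (a : ℝ), T (f + a • eZero p) = T f + a • T (eZero p)

/-- Rational points of `[0,1]` tending to `s`. -/
def ratNhds01 (s : ℝ) : Filter ℚ := comap (fun q : ℚ => (q : ℝ)) (𝓝[Icc 0 1] s)

/-- The function `s ↦ Φ(s)(s)` attached to a family `Φ(x)`, `x ∈ [0,1]`, of elements of
`L_p([0,1])`. Each `Φ(x)` is defined only up to a null set that may depend on `x`; the value at `s`
is the limit of `Φ(q)(s)` as `q → s` through the rationals of `[0,1]`, which only uses countably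
many of the classes. If the family has a version that is continuous in `x`, this is the diagonal of
that version (`lpDiagonal_eq_of_version`). For `Φ(x) = T(|e₁ - x|)` or `Φ(x) = T((e₁ - x)²)` with
`T` sublinear and monotone, the limit exists for almost every `s`
(`tendsto_lpDiagonal_absShift`, `tendsto_lpDiagonal_sqShift`). -/
noncomputable def lpDiagonal {p : ℝ≥0∞} (Φ : ℝ → Lp01 p) (s : ℝ) : ℝ :=
  limUnder (ratNhds01 s) (fun q : ℚ => Φ (q : ℝ) s)

theorem ratNhds01_neBot {s : ℝ} (hs : s ∈ Icc (0 : ℝ) 1) : (ratNhds01 s).NeBot := by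
  refine comap_neBot_iff.2 fun t ht => ?_
  obtain ⟨ε, hε, hsub⟩ := Metric.mem_nhdsWithin_iff.1 ht
  have hlt : max 0 (s - ε) < min 1 (s + ε) := by
    simp only [max_lt_iff, lt_min_iff]
    obtain ⟨h0, h1⟩ := hs
    refine ⟨⟨by norm_num, by linarith⟩, by linarith, by linarith⟩
  obtain ⟨q, hq1, hq2⟩ := exists_rat_btwn hlt
  simp only [max_lt_iff, lt_min_iff] at hq1 hq2
  refine ⟨q, hsub ⟨?_, hq1.1.le, hq2.1.le⟩⟩
  rw [Metric.mem_ball, Real.dist_eq, abs_lt]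
  constructor <;> linarith [hq1.2, hq2.2]

theorem eventually_mem_ratNhds01 (s : ℝ) : ∀ᶠ q : ℚ in ratNhds01 s, (q : ℝ) ∈ Icc (0 : ℝ) 1 :=
  tendsto_comap.eventually (eventually_mem_nhdsWithin)

theorem lpDiagonal_eq_of_version {p : ℝ≥0∞} {Φ : ℝ → Lp01 p} {G : ℝ → ℝ → ℝ}
    (hG : ∀ x ∈ Icc (0 : ℝ) 1, G x =ᵐ[leb01] Φ x)
    (hc : ∀ᵐ s ∂leb01, ContinuousOn (fun x => G x s) (Icc 0 1)) :
    lpDiagonal Φ =ᵐ[leb01] fun s => G s s := by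
  have h1 : ∀ᵐ s ∂leb01, ∀ q : ℚ, (q : ℝ) ∈ Icc (0 : ℝ) 1 → G q s = Φ q s := by
    rw [ae_all_iff]
    intro q
    by_cases hq : (q : ℝ) ∈ Icc (0 : ℝ) 1
    · filter_upwards [hG q hq] with s hs _ using hs
    · exact Eventually.of_forall fun s h => absurd h hq
  filter_upwards [h1, hc, ae_restrict_mem measurableSet_Icc] with s h1 hc hs
  have := ratNhds01_neBot hs
  refine Tendsto.limUnder_eq ?_
  have h2 : Tendsto (fun q : ℚ => G q s) (ratNhds01 s) (𝓝 (G s s)) :=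
    (hc s hs).tendsto.comp tendsto_comap
  refine h2.congr' ?_
  filter_upwards [eventually_mem_ratNhds01 s] with q hq using h1 q hq

theorem tendsto_lpDiagonal {p : ℝ≥0∞} {Φ : ℝ → Lp01 p} (h : ℝ → ℝ)
    (hΦ : ∀ x ∈ Icc (0 : ℝ) 1, ∀ y ∈ Icc (0 : ℝ) 1,
      ∀ᵐ s ∂leb01, |Φ x s - Φ y s| ≤ |x - y| * h s) :
    ∀ᵐ s ∂leb01, Tendsto (fun q : ℚ => Φ q s) (ratNhds01 s) (𝓝 (lpDiagonal Φ s)) := by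
  have h1 : ∀ᵐ s ∂leb01, ∀ q r : ℚ, (q : ℝ) ∈ Icc (0 : ℝ) 1 → (r : ℝ) ∈ Icc (0 : ℝ) 1 →
      |Φ q s - Φ r s| ≤ |(q : ℝ) - r| * h s := by
    rw [ae_all_iff]
    intro q
    rw [ae_all_iff]
    intro r
    by_cases hq : (q : ℝ) ∈ Icc (0 : ℝ) 1 ∧ (r : ℝ) ∈ Icc (0 : ℝ) 1
    · filter_upwards [hΦ q hq.1 r hq.2] with s hs _ _ using hs
    · exact Eventually.of_forall fun s h1 h2 => absurd ⟨h1, h2⟩ hq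
  filter_upwards [h1, ae_restrict_mem measurableSet_Icc] with s h1 hs
  have := ratNhds01_neBot hs
  refine tendsto_nhds_limUnder (cauchy_map_iff_exists_tendsto.1 ?_)
  refine Metric.cauchy_iff.2 ⟨inferInstance, fun ε hε => ?_⟩
  have hpos : 0 < |h s| + 1 := by positivity
  have hδ : 0 < ε / (2 * (|h s| + 1)) := by positivity
  have hev : ∀ᶠ q : ℚ in ratNhds01 s, dist (q : ℝ) s < ε / (2 * (|h s| + 1)) :=
    tendsto_comap.eventually (nhdsWithin_le_nhds (Metric.ball_mem_nhds s hδ))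
  refine ⟨_, image_mem_map (hev.and (eventually_mem_ratNhds01 s)), ?_⟩
  rintro _ ⟨q, ⟨hq, hq'⟩, rfl⟩ _ ⟨r, ⟨hr, hr'⟩, rfl⟩
  have hd : |(q : ℝ) - r| < ε / (|h s| + 1) := by
    have h3 : dist (q : ℝ) r ≤ dist (q : ℝ) s + dist (r : ℝ) s := dist_triangle_right _ _ _
    have h4 : ε / (|h s| + 1) = ε / (2 * (|h s| + 1)) + ε / (2 * (|h s| + 1)) := by
      field_simp; ring
    rw [← Real.dist_eq, h4]; linarith
  rw [Real.dist_eq]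
  calc |Φ q s - Φ r s| ≤ |(q : ℝ) - r| * h s := h1 q r hq' hr'
    _ ≤ |(q : ℝ) - r| * (|h s| + 1) := by
        gcongr; linarith [le_abs_self (h s)]
    _ < ε / (|h s| + 1) * (|h s| + 1) := by gcongr
    _ = ε := by field_simp

theorem contLp_le {p : ℝ≥0∞} {u v : ℝ → ℝ} (hu : Continuous u) (hv : Continuous v)
    (h : ∀ t ∈ Icc (0 : ℝ) 1, u t ≤ v t) : contLp p u hu ≤ contLp p v hv := by
  rw [← Lp.coeFn_le]
  filter_upwards [(memLp_of_continuous01 p hu).coeFn_toLp,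
    (memLp_of_continuous01 p hv).coeFn_toLp, ae_restrict_mem measurableSet_Icc] with s h1 h2 hs
  have := h s hs
  simp only [contLp]
  rw [h1, h2]
  exact this

theorem op_contLp_sub_le {p : ℝ≥0∞} {T : Lp01 p → Lp01 p} (hT : IsSublinearOp T)
    (hm : Monotone T) {u v : ℝ → ℝ} (hu : Continuous u) (hv : Continuous v) {c : ℝ} (hc : 0 ≤ c)
    (h : ∀ t ∈ Icc (0 : ℝ) 1, u t ≤ v t + c) :
    ∀ᵐ s ∂leb01, T (contLp p u hu) s - T (contLp p v hv) s ≤ c * T (eZero p) s := by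
  have h1 : contLp p u hu ≤ contLp p v hv + c • eZero p := by
    have h2 : contLp p v hv + c • eZero p
        = contLp p (fun t => v t + c) (by fun_prop) := by
      have h4 : c • eZero p = contLp p (fun _ => c) continuous_const := by
        rw [eZero, contLp, contLp, ← MemLp.toLp_const_smul]
        congr 1
        ext t
        simp
      rw [h4, contLp, contLp, ← MemLp.toLp_add]
      rfl
    rw [h2]
    exact contLp_le _ _ h
  have h3 : T (contLp p u hu) ≤ T (contLp p v hv) + c • T (eZero p) :=
    (hm h1).trans ((hT.1 _ _).trans_eq (by rw [hT.2 c _ hc]))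
  rw [← Lp.coeFn_le] at h3
  filter_upwards [h3, Lp.coeFn_add (T (contLp p v hv)) (c • T (eZero p)),
    Lp.coeFn_smul c (T (eZero p))] with s h3 h4 h5
  rw [h4, Pi.add_apply, h5, Pi.smul_apply, smul_eq_mul] at h3
  linarith

theorem tendsto_lpDiagonal_absShift {p : ℝ≥0∞} {T : Lp01 p → Lp01 p} (hT : IsSublinearOp T)
    (hm : Monotone T) :
    ∀ᵐ s ∂leb01, Tendsto (fun q : ℚ => T (absShift p q) s) (ratNhds01 s)
      (𝓝 (lpDiagonal (fun x => T (absShift p x)) s)) := by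
  refine tendsto_lpDiagonal (Φ := fun x => T (absShift p x)) (fun s => T (eZero p) s) ?_
  have key : ∀ x y : ℝ, ∀ t ∈ Icc (0 : ℝ) 1, |t - x| ≤ |t - y| + |x - y| := fun x y t _ => by
    rw [abs_sub_comm x y]; exact abs_sub_le t y x
  intro x _ y _
  filter_upwards [op_contLp_sub_le hT hm _ _ (abs_nonneg (x - y)) (key x y),
    op_contLp_sub_le hT hm _ _ (abs_nonneg (y - x)) (key y x)] with s h1 h2
  rw [abs_sub_comm y x] at h2
  exact abs_sub_le_iff.2 ⟨h1, h2⟩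

theorem tendsto_lpDiagonal_sqShift {p : ℝ≥0∞} {T : Lp01 p → Lp01 p} (hT : IsSublinearOp T)
    (hm : Monotone T) :
    ∀ᵐ s ∂leb01, Tendsto (fun q : ℚ => T (sqShift p q) s) (ratNhds01 s)
      (𝓝 (lpDiagonal (fun x => T (sqShift p x)) s)) := by
  refine tendsto_lpDiagonal (Φ := fun x => T (sqShift p x)) (fun s => 2 * T (eZero p) s) ?_
  have key : ∀ x ∈ Icc (0 : ℝ) 1, ∀ y ∈ Icc (0 : ℝ) 1, ∀ t ∈ Icc (0 : ℝ) 1,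
      (t - x) ^ 2 ≤ (t - y) ^ 2 + 2 * |x - y| := by
    rintro x ⟨_, _⟩ y ⟨_, _⟩ t ⟨_, _⟩
    have e : (t - x) ^ 2 - (t - y) ^ 2 = (x - y) * (x + y - 2 * t) := by ring
    have h2 : |x + y - 2 * t| ≤ 2 := abs_le.2 ⟨by linarith, by linarith⟩
    have h3 : (x - y) * (x + y - 2 * t) ≤ |x - y| * 2 :=
      (le_abs_self _).trans (by rw [abs_mul]; gcongr)
    linarith
  intro x hx y hy
  filter_upwards [op_contLp_sub_le hT hm _ _ (by positivity) (key x hx y hy),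
    op_contLp_sub_le hT hm _ _ (by positivity) (key y hy x hx)] with s h1 h2
  rw [abs_sub_comm y x] at h2
  refine abs_sub_le_iff.2 ⟨h1.trans_eq (by ring), h2.trans_eq (by ring)⟩

/-- The quantity `t_{n,p}` of the operator `T = T_n`: the square root of the maximum of
`‖T e₀ - e₀‖_p`, `‖T(|e₁ - x|)(x)‖_p` and `‖T((e₁ - x)²)(x)‖_∞`. It takes values in `[0,∞]`,
because the function in the last norm need not be essentially bounded. -/
noncomputable def tParam {p : ℝ≥0∞} (T : Lp01 p → Lp01 p) : ℝ≥0∞ :=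
  (max (max (‖T (eZero p) - eZero p‖ₑ)
      (eLpNorm (lpDiagonal fun x => T (absShift p x)) p leb01))
    (eLpNorm (lpDiagonal fun x => T (sqShift p x)) ∞ leb01)) ^ (1 / 2 : ℝ)

/-- The difference `Δ_h^r f(x) = ∑_{j=0}^r (-1)^j (r choose j) f(x + (r - j) h)`. -/
noncomputable def rDiff (r : ℕ) (h : ℝ) (f : ℝ → ℝ) (x : ℝ) : ℝ :=
  ∑ j ∈ Finset.range (r + 1), (-1 : ℝ) ^ j * (r.choose j : ℝ) * f (x + ((r : ℝ) - j) * h)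

/-- The modulus of smoothness `ω_{r,p}(f; δ) = sup_{|h| ≤ δ} ‖Δ_h^r f‖_p`, the norm being taken
over the points `x` for which all the nodes `x, x + h, …, x + r h` lie in `[0,1]`. -/
noncomputable def omegaMod (r : ℕ) (p : ℝ≥0∞) (f : ℝ → ℝ) (δ : ℝ≥0∞) : ℝ≥0∞ :=
  ⨆ (h : ℝ) (_ : ENNReal.ofReal |h| ≤ δ),
    eLpNorm (rDiff r h f) p
      (volume.restrict {x : ℝ | x ∈ Icc (0 : ℝ) 1 ∧ x + (r : ℝ) * h ∈ Icc (0 : ℝ) 1})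

/-!
The proof compares `T f` with `T g` for a function `g` of class `C²` close to `f`.

For such `g` and `x` in `[0,1]`, Taylor's formula (`HasC2Derivs.abs_sub_le`) gives
`|g - g x| ≤ |g' x| |e₁ - x| + m x (e₁ - x)²` on `[0,1]`, where `m` is the Hardy–Littlewood maximal
function of `|g''|`. Applying `T` and using strong translatability to take out the constant `g x`,
one gets `|T g x - g x T 1 x| ≤ |g' x| T(|e₁ - x|)(x) + m x T((e₁ - x)²)(x)`. As `T` of a function
is only a class, this is done for rational points `q` in place of `x` and carried over to almost
every `s` by letting `q → s`, the functions `g`, `g'` and `m` being continuous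
(`IsSublinearOp.ae_abs_op_sub_mul_le`). The first factor `|g'|` is bounded uniformly by Landau's
inequality and the second one, `m`, in `L_p` by the maximal inequality (`exists_eLpNorm_maxAvg_le`),
the only place where `p > 1` is needed; both bounds are multiples of `‖g‖_p + ‖g''‖_p`. Hence
`‖T g - g‖_p ≤ C t² (‖g‖_p + ‖g''‖_p)` (`exists_enorm_op_contLp_sub_le`).

The maximal inequality comes from Vitali's covering lemma, applied to the truncations of the
function, and integration over the levels.

For continuous `f` the function `g` is built from Steklov means of second order
(`exists_hasC2Derivs_approx`): `‖f - g‖_p` and `t² ‖g''‖_p` are at most a multiple of `ω₂(f; t)`.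
Since `T` is `L_p`-Lipschitz (`IsSublinearOp.norm_sub_le`), the theorem follows for `0 < t ≤ 1/8`,
and for arbitrary `f` by approximation with continuous functions. For `t > 1/8` the boundedness of
the operators is enough, and for `t = 0` the operator is the identity on polynomials, hence on
continuous functions. In particular the constant depends only on `p` and on the bound of the
operators.
-/

/-! ### The Hardy–Littlewood maximal inequality on the unit interval -/

/-- Vitali's covering lemma turned into a weak type estimate: if every point of `s` lies in an
interval inside `[0,1]` over which the average of `K` is at least `l`, then `s` is small. -/
theorem mul_volume_le_of_closedBall_averages {K : ℝ → ℝ≥0∞} {l : ℝ≥0∞} {s : Set ℝ}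
    (hs : ∀ x ∈ s, ∃ c r : ℝ, 0 < r ∧ x ∈ Metric.closedBall c r ∧
      Metric.closedBall c r ⊆ Icc 0 1 ∧
      l * volume (Metric.closedBall c r) ≤ ∫⁻ y in Metric.closedBall c r, K y) :
    l * volume s ≤ 4 * ∫⁻ y in Icc (0 : ℝ) 1, K y := by
  choose! c r hr hx hsub hl using hs
  have hr1 : ∀ x ∈ s, r x ≤ 1 := by
    intro x hxs
    have h1 : c x + r x ∈ Icc (0 : ℝ) 1 := hsub x hxs (by
      rw [Real.closedBall_eq_Icc]; constructor <;> linarith [hr x hxs])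
    have h2 : c x - r x ∈ Icc (0 : ℝ) 1 := hsub x hxs (by
      rw [Real.closedBall_eq_Icc]; constructor <;> linarith [hr x hxs])
    linarith [h1.2, h2.1, hr x hxs]
  obtain ⟨u, hus, hdisj, hcov⟩ :=
    Vitali.exists_disjoint_subfamily_covering_enlargement_closedBall s c r 1 hr1 4 (by norm_num)
  have hcount : u.Countable := by
    refine hdisj.countable_of_nonempty_interior fun i hi => ?_
    exact ⟨c i, Metric.ball_subset_interior_closedBall (Metric.mem_ball_self (hr i (hus hi)))⟩
  have hvol : ∀ b ∈ u, volume (Metric.closedBall (c b) (4 * r b))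
      = 4 * volume (Metric.closedBall (c b) (r b)) := by
    intro b hb
    rw [Real.volume_closedBall, Real.volume_closedBall, ← mul_assoc, mul_comm (2 : ℝ) 4, mul_assoc,
      ENNReal.ofReal_mul (by norm_num)]
    norm_num
  have hsu : s ⊆ ⋃ b ∈ u, Metric.closedBall (c b) (4 * r b) := by
    intro x hxs
    obtain ⟨b, hb, hsubb⟩ := hcov x hxs
    exact mem_iUnion₂.2 ⟨b, hb, hsubb (hx x hxs)⟩
  calc l * volume s
      ≤ l * ∑' b : u, volume (Metric.closedBall (c b) (4 * r b)) := by
        gcongr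
        exact (measure_mono hsu).trans (measure_biUnion_le _ hcount _)
    _ = 4 * ∑' b : u, l * volume (Metric.closedBall (c b) (r b)) := by
        rw [← ENNReal.tsum_mul_left, ← ENNReal.tsum_mul_left]
        refine tsum_congr fun b => ?_
        rw [hvol b b.2]; ring
    _ ≤ 4 * ∑' b : u, ∫⁻ y in Metric.closedBall (c b) (r b), K y := by
        gcongr with b
        exact hl b (hus b.2)
    _ = 4 * ∫⁻ y in ⋃ b ∈ u, Metric.closedBall (c b) (r b), K y := by
        rw [lintegral_biUnion hcount (fun b _ => Metric.isClosed_closedBall.measurableSet) hdisj]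
    _ ≤ 4 * ∫⁻ y in Icc (0 : ℝ) 1, K y := by
        gcongr
        exact iUnion₂_subset fun b hb => hsub b (hus hb)

/-- The average of `k` over the interval with end points `x` and `t`; it is `k x` when `t = x`. -/
noncomputable def segAvg (k : ℝ → ℝ) (x t : ℝ) : ℝ := ∫ u in (0 : ℝ)..1, k (x + (t - x) * u)

/-- The maximal function of `k` on `[0,1]`, in which the averages run over the intervals in
`[0,1]` with `x` as an end point. -/
noncomputable def maxAvg (k : ℝ → ℝ) (x : ℝ) : ℝ := sSup (segAvg k x '' Icc 0 1)

theorem continuous_segAvg {k : ℝ → ℝ} (hk : Continuous k) :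
    Continuous (Function.uncurry (segAvg k)) := by
  refine intervalIntegral.continuous_parametric_intervalIntegral_of_continuous'
    (f := fun (z : ℝ × ℝ) u => k (z.1 + (z.2 - z.1) * u)) ?_ 0 1
  fun_prop

theorem continuous_maxAvg {k : ℝ → ℝ} (hk : Continuous k) : Continuous (maxAvg k) :=
  isCompact_Icc.continuous_sSup (continuous_segAvg hk)

theorem mul_segAvg (k : ℝ → ℝ) (x t : ℝ) : (t - x) * segAvg k x t = ∫ y in x..t, k y := by
  simp [segAvg]

theorem segAvg_le_maxAvg {k : ℝ → ℝ} (hk : Continuous k) (x : ℝ) {t : ℝ} (ht : t ∈ Icc (0 : ℝ) 1) :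
    segAvg k x t ≤ maxAvg k x := by
  have hc : Continuous (segAvg k x) := (continuous_segAvg hk).comp (by fun_prop :
    Continuous fun t : ℝ => (x, t))
  exact le_csSup (isCompact_Icc.bddAbove_image hc.continuousOn) (mem_image_of_mem _ ht)

theorem maxAvg_nonneg {k : ℝ → ℝ} (hk : Continuous k) (h0 : ∀ x, 0 ≤ k x) (x : ℝ) :
    0 ≤ maxAvg k x :=
  (intervalIntegral.integral_nonneg (by norm_num) fun _ _ => h0 _).trans
    (segAvg_le_maxAvg hk x (t := 0) (by simp))

theorem exists_lt_segAvg {k : ℝ → ℝ} (hk : Continuous k) {x l : ℝ} (hx : x ∈ Icc (0 : ℝ) 1)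
    (hl : l < maxAvg k x) : ∃ t ∈ Icc (0 : ℝ) 1, t ≠ x ∧ l < segAvg k x t := by
  obtain ⟨_, ⟨t, ht, rfl⟩, hlt⟩ := exists_lt_of_lt_csSup ((nonempty_Icc.2 zero_le_one).image _) hl
  by_cases htx : t = x
  · subst htx
    have hc : Continuous (segAvg k t) := (continuous_segAvg hk).comp (by fun_prop :
      Continuous fun s : ℝ => (t, s))
    obtain ⟨ε, hε, hball⟩ := Metric.isOpen_iff.1 (isOpen_lt continuous_const hc) t hlt
    rcases lt_or_ge t 1 with h1 | h1
    · have hpos : 0 < min (ε / 2) (1 - t) := lt_min (by linarith) (by linarith)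
      refine ⟨t + min (ε / 2) (1 - t), ⟨by linarith [ht.1], ?_⟩, by linarith, hball ?_⟩
      · linarith [min_le_right (ε / 2) (1 - t)]
      · rw [Metric.mem_ball, Real.dist_eq, add_sub_cancel_left, abs_of_pos hpos]
        linarith [min_le_left (ε / 2) (1 - t)]
    · have hpos : 0 < min (ε / 2) t := lt_min (by linarith) (by linarith)
      refine ⟨t - min (ε / 2) t, ⟨?_, by linarith [ht.2]⟩, by linarith, hball ?_⟩
      · linarith [min_le_right (ε / 2) t]
      · rw [Metric.mem_ball, Real.dist_eq, sub_sub_cancel_left, abs_neg, abs_of_pos hpos]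
        linarith [min_le_left (ε / 2) t]
  · exact ⟨t, ht, htx, hlt⟩

/-- If the average of `k` over an interval exceeds `l`, the part of `k` above `l / 2` still has
average at least `l / 2` there. -/
theorem half_mul_volume_le_of_lt_integral {k : ℝ → ℝ} (hk : Continuous k) (h0 : ∀ x, 0 ≤ k x)
    {l a b : ℝ} (hl : 0 < l) (hab : a < b) (h : l * (b - a) < ∫ y in a..b, k y) :
    ENNReal.ofReal (l / 2) * volume (Icc a b)
      ≤ ∫⁻ y in Icc a b, {y | l / 2 < k y}.indicator (fun y => ENNReal.ofReal (k y)) y := by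
  have hmeas : MeasurableSet {y | l / 2 < k y} := measurableSet_lt measurable_const hk.measurable
  have h1 : ENNReal.ofReal (∫ y in a..b, k y) = ∫⁻ y in Icc a b, ENNReal.ofReal (k y) := by
    rw [intervalIntegral.integral_of_le hab.le, ← integral_Icc_eq_integral_Ioc,
      ofReal_integral_eq_lintegral_ofReal]
    · exact hk.integrableOn_Icc
    · exact Eventually.of_forall h0
  have h2 : ∫⁻ y in Icc a b, ENNReal.ofReal (k y)
      ≤ (∫⁻ y in Icc a b, {y | l / 2 < k y}.indicator (fun y => ENNReal.ofReal (k y)) y)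
        + ENNReal.ofReal (l / 2) * volume (Icc a b) := by
    rw [← setLIntegral_const, ← lintegral_add_right _ measurable_const]
    refine lintegral_mono fun y => ?_
    by_cases hy : l / 2 < k y
    · simp [indicator, hy]
    · simp only [indicator, mem_ofPred_eq, hy, if_false, zero_add]
      exact ENNReal.ofReal_le_ofReal (not_lt.1 hy)
  have h3 : ENNReal.ofReal (l / 2) * volume (Icc a b) + ENNReal.ofReal (l / 2) * volume (Icc a b)
      ≤ ENNReal.ofReal (∫ y in a..b, k y) := by
    rw [Real.volume_Icc, ← ENNReal.ofReal_mul (by positivity), ← ENNReal.ofReal_add]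
    · exact ENNReal.ofReal_le_ofReal (by linarith)
    · have : 0 < b - a := by linarith
      positivity
    · have : 0 < b - a := by linarith
      positivity
  have hfin : ENNReal.ofReal (l / 2) * volume (Icc a b) ≠ ∞ := by
    rw [Real.volume_Icc]; exact ENNReal.mul_ne_top ENNReal.ofReal_ne_top ENNReal.ofReal_ne_top
  exact (ENNReal.add_le_add_iff_right hfin).1 (h3.trans (h1.trans_le h2))

theorem weak_type_maxAvg {k : ℝ → ℝ} (hk : Continuous k) (h0 : ∀ x, 0 ≤ k x) {l : ℝ}
    (hl : 0 < l) :
    ENNReal.ofReal l * leb01 {x | l < maxAvg k x}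
      ≤ 8 * ∫⁻ y in {y | l / 2 < k y}, ENNReal.ofReal (k y) ∂leb01 := by
  have hmeas : MeasurableSet {y | l / 2 < k y} := measurableSet_lt measurable_const hk.measurable
  have hmeas' : MeasurableSet {x | l < maxAvg k x} :=
    measurableSet_lt measurable_const (continuous_maxAvg hk).measurable
  have key : ENNReal.ofReal (l / 2) * volume ({x | l < maxAvg k x} ∩ Icc 0 1)
      ≤ 4 * ∫⁻ y in Icc (0 : ℝ) 1,
        {y | l / 2 < k y}.indicator (fun y => ENNReal.ofReal (k y)) y := by
    refine mul_volume_le_of_closedBall_averages ?_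
    rintro x ⟨hx, hx01⟩
    obtain ⟨t, ht, htx, hlt⟩ := exists_lt_segAvg hk hx01 hx
    have hball : ∀ a b : ℝ, Metric.closedBall ((a + b) / 2) ((b - a) / 2) = Icc a b := by
      intro a b; rw [Real.closedBall_eq_Icc]; congr 1 <;> ring
    have hm := mul_segAvg k x t
    rcases lt_or_gt_of_ne htx with h | h
    · refine ⟨(t + x) / 2, (x - t) / 2, by linarith, ?_, ?_, ?_⟩ <;> rw [hball]
      · exact ⟨h.le, le_rfl⟩
      · exact Icc_subset_Icc ht.1 hx01.2
      · refine half_mul_volume_le_of_lt_integral hk h0 hl h ?_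
        rw [intervalIntegral.integral_symm, ← hm]
        nlinarith
    · refine ⟨(x + t) / 2, (t - x) / 2, by linarith, ?_, ?_, ?_⟩ <;> rw [hball]
      · exact ⟨le_rfl, h.le⟩
      · exact Icc_subset_Icc hx01.1 ht.2
      · refine half_mul_volume_le_of_lt_integral hk h0 hl h ?_
        rw [← hm]
        nlinarith
  rw [lintegral_indicator hmeas] at key
  rw [Measure.restrict_apply hmeas']
  have e : ENNReal.ofReal l = 2 * ENNReal.ofReal (l / 2) := by
    rw [← ENNReal.ofReal_ofNat, ← ENNReal.ofReal_mul (by norm_num)]; congr 1; ring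
  calc _ = 2 * (ENNReal.ofReal (l / 2) * volume ({x | l < maxAvg k x} ∩ Icc 0 1)) := by
        rw [e, mul_assoc]
    _ ≤ 2 * (4 * ∫⁻ y in {y | l / 2 < k y}, ENNReal.ofReal (k y) ∂leb01) := by gcongr
    _ = _ := by rw [← mul_assoc]; norm_num

/-- Marcinkiewicz interpolation between the truncated weak type `(1,1)` estimate and the trivial
bound at infinity: integrate the weak type estimate against `l ^ (p - 2)`. -/
theorem lintegral_rpow_le_of_truncated_weak_type {α : Type*} [MeasurableSpace α] {μ : Measure α}
    [SFinite μ] {m k : α → ℝ} {p : ℝ} (hp : 1 < p) {A : ℝ≥0∞} (hm : Measurable m)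
    (hk : Measurable k) (hm0 : ∀ x, 0 ≤ m x) (hk0 : ∀ x, 0 ≤ k x)
    (hweak : ∀ l : ℝ, 0 < l → ENNReal.ofReal l * μ {x | l < m x}
      ≤ A * ∫⁻ y in {y | l / 2 < k y}, ENNReal.ofReal (k y) ∂μ) :
    ∫⁻ x, ENNReal.ofReal (m x ^ p) ∂μ
      ≤ ENNReal.ofReal p * A * ENNReal.ofReal (2 ^ (p - 1) / (p - 1))
        * ∫⁻ x, ENNReal.ofReal (k x ^ p) ∂μ := by
  have hmeas : MeasurableSet {z : ℝ × α | z.1 / 2 < k z.2} :=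
    measurableSet_lt (by fun_prop) (by fun_prop)
  have hslice : ∀ l : ℝ, MeasurableSet {y | l / 2 < k y} := fun l =>
    measurableSet_lt measurable_const hk
  -- the inner integral after Tonelli
  have hinner : ∀ y, ∫⁻ l in Ioi (0 : ℝ), {z : ℝ × α | z.1 / 2 < k z.2}.indicator
      (fun z => ENNReal.ofReal (k z.2) * ENNReal.ofReal (z.1 ^ (p - 2))) (l, y)
      = ENNReal.ofReal (2 ^ (p - 1) / (p - 1)) * ENNReal.ofReal (k y ^ p) := by
    intro y
    have hset : Ioi (0 : ℝ) ∩ {l : ℝ | l / 2 < k y} = Ioo 0 (2 * k y) := by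
      ext l; simp only [mem_inter_iff, mem_Ioi, mem_ofPred_eq, mem_Ioo]
      constructor <;> rintro ⟨h1, h2⟩ <;> exact ⟨h1, by linarith⟩
    have h2k : 0 ≤ 2 * k y := by linarith [hk0 y]
    have hint : IntervalIntegrable (fun l : ℝ => l ^ (p - 2)) volume 0 (2 * k y) :=
      intervalIntegral.intervalIntegrable_rpow' (by linarith)
    calc _ = ∫⁻ l in Ioi (0 : ℝ), {l : ℝ | l / 2 < k y}.indicator
          (fun l => ENNReal.ofReal (k y) * ENNReal.ofReal (l ^ (p - 2))) l := rfl
      _ = ∫⁻ l in Ioo 0 (2 * k y), ENNReal.ofReal (k y) * ENNReal.ofReal (l ^ (p - 2)) := by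
          rw [lintegral_indicator (measurableSet_lt (by fun_prop) measurable_const),
            Measure.restrict_restrict (measurableSet_lt (by fun_prop) measurable_const),
            inter_comm, hset]
      _ = ENNReal.ofReal (k y) * ENNReal.ofReal (∫ l in (0 : ℝ)..(2 * k y), l ^ (p - 2)) := by
          rw [lintegral_const_mul _ (by fun_prop), intervalIntegral.integral_of_le h2k,
            ofReal_integral_eq_lintegral_ofReal, setLIntegral_congr Ioo_ae_eq_Ioc]
          · exact (intervalIntegrable_iff_integrableOn_Ioc_of_le h2k).1 hint
          · exact (ae_restrict_iff' measurableSet_Ioc).2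
              (Eventually.of_forall fun l hl => Real.rpow_nonneg hl.1.le _)
      _ = _ := by
          rw [integral_rpow (Or.inl (by linarith)), ← ENNReal.ofReal_mul (hk0 y),
            ← ENNReal.ofReal_mul (div_nonneg (by positivity) (by linarith))]
          congr 1
          have e : p - 2 + 1 = p - 1 := by ring
          have hp1 : p - 1 ≠ 0 := by linarith
          rw [e, Real.zero_rpow hp1, Real.mul_rpow (by norm_num) (hk0 y)]
          rcases (hk0 y).eq_or_lt with h | h
          · rw [← h, Real.zero_rpow (by linarith : p ≠ 0)]; simp
          · have : k y ^ p = k y * k y ^ (p - 1) := by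
              rw [← Real.rpow_one_add' h.le (by linarith)]; congr 1; ring
            rw [this]; field_simp; ring
  calc ∫⁻ x, ENNReal.ofReal (m x ^ p) ∂μ
      = ENNReal.ofReal p * ∫⁻ l in Ioi (0 : ℝ), μ {x | l < m x} * ENNReal.ofReal (l ^ (p - 1)) :=
        lintegral_rpow_eq_lintegral_meas_lt_mul μ (Eventually.of_forall hm0) hm.aemeasurable
          (by linarith)
    _ ≤ ENNReal.ofReal p * ∫⁻ l in Ioi (0 : ℝ), A * ∫⁻ y,
          {z : ℝ × α | z.1 / 2 < k z.2}.indicator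
            (fun z => ENNReal.ofReal (k z.2) * ENNReal.ofReal (z.1 ^ (p - 2))) (l, y) ∂μ := by
        gcongr ENNReal.ofReal p * ?_
        refine setLIntegral_mono' measurableSet_Ioi fun l (hl : 0 < l) => ?_
        have e1 : l ^ (p - 1) = l * l ^ (p - 2) := by
          rw [← Real.rpow_one_add' hl.le (by linarith)]; congr 1; ring
        have e2 : ∫⁻ y, {z : ℝ × α | z.1 / 2 < k z.2}.indicator
            (fun z => ENNReal.ofReal (k z.2) * ENNReal.ofReal (z.1 ^ (p - 2))) (l, y) ∂μ
            = (∫⁻ y in {y | l / 2 < k y}, ENNReal.ofReal (k y) ∂μ)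
              * ENNReal.ofReal (l ^ (p - 2)) := by
          rw [← lintegral_mul_const _ (by fun_prop), ← lintegral_indicator (hslice l)]
          rfl
        rw [e1, ENNReal.ofReal_mul hl.le, e2, ← mul_assoc, ← mul_assoc,
          mul_comm (μ _) (ENNReal.ofReal l)]
        gcongr ?_ * _
        exact hweak l hl
    _ = ENNReal.ofReal p * (A * ∫⁻ y, (∫⁻ l in Ioi (0 : ℝ),
          {z : ℝ × α | z.1 / 2 < k z.2}.indicator
            (fun z => ENNReal.ofReal (k z.2) * ENNReal.ofReal (z.1 ^ (p - 2))) (l, y)) ∂μ) := by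
        have hM : Measurable ({z : ℝ × α | z.1 / 2 < k z.2}.indicator
            (fun z => ENNReal.ofReal (k z.2) * ENNReal.ofReal (z.1 ^ (p - 2)))) :=
          Measurable.indicator (by fun_prop) hmeas
        rw [lintegral_const_mul _ hM.lintegral_prod_right',
          lintegral_lintegral_swap (f := fun l y =>
          {z : ℝ × α | z.1 / 2 < k z.2}.indicator
            (fun z => ENNReal.ofReal (k z.2) * ENNReal.ofReal (z.1 ^ (p - 2))) (l, y))
          hM.aemeasurable]
    _ = _ := by
        simp_rw [hinner]
        rw [lintegral_const_mul _ (by fun_prop)]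
        ring

/-- The Hardy–Littlewood maximal inequality in `L_p([0,1])`, `1 < p < ∞`. -/
theorem exists_eLpNorm_maxAvg_le {p : ℝ≥0∞} (hp : 1 < p) (hp' : p < ∞) :
    ∃ C : ℝ≥0, ∀ k : ℝ → ℝ, Continuous k → (∀ x, 0 ≤ k x) →
      eLpNorm (maxAvg k) p leb01 ≤ C * eLpNorm k p leb01 := by
  have hp1 : 1 < p.toReal := by
    rw [← ENNReal.toReal_one]; exact (ENNReal.toReal_lt_toReal (by simp) hp'.ne).2 hp
  set B : ℝ≥0∞ := ENNReal.ofReal p.toReal * 8 * ENNReal.ofReal (2 ^ (p.toReal - 1) / (p.toReal - 1))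
  have hB : B ^ (1 / p.toReal) ≠ ∞ := by
    refine ENNReal.rpow_ne_top_of_nonneg (by positivity) ?_
    exact ENNReal.mul_ne_top (ENNReal.mul_ne_top ENNReal.ofReal_ne_top (by simp))
      ENNReal.ofReal_ne_top
  refine ⟨(B ^ (1 / p.toReal)).toNNReal, fun k hk h0 => ?_⟩
  rw [ENNReal.coe_toNNReal hB]
  have hconv : ∀ m : ℝ → ℝ, (∀ x, 0 ≤ m x) → eLpNorm m p leb01
      = (∫⁻ x, ENNReal.ofReal (m x ^ p.toReal) ∂leb01) ^ (1 / p.toReal) := by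
    intro m hm
    rw [eLpNorm_eq_lintegral_rpow_enorm_toReal (by positivity) hp'.ne]
    congr 1
    refine lintegral_congr fun x => ?_
    rw [Real.enorm_eq_ofReal (hm x), ENNReal.ofReal_rpow_of_nonneg (hm x) (by positivity)]
  rw [hconv _ (maxAvg_nonneg hk h0), hconv _ h0,
    ← ENNReal.mul_rpow_of_nonneg _ _ (by positivity)]
  gcongr
  exact lintegral_rpow_le_of_truncated_weak_type hp1 (continuous_maxAvg hk).measurable
    hk.measurable (maxAvg_nonneg hk h0) h0 fun l hl => weak_type_maxAvg hk h0 hl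

/-! ### Twice continuously differentiable functions -/

/-- `g` is of class `C²` on the line, with first derivative `g₁` and second derivative `g₂`. -/
structure HasC2Derivs (g g₁ g₂ : ℝ → ℝ) : Prop where
  hasDerivAt : ∀ x, HasDerivAt g (g₁ x) x
  hasDerivAt' : ∀ x, HasDerivAt g₁ (g₂ x) x
  continuous_snd : Continuous g₂

namespace HasC2Derivs

variable {g g₁ g₂ k k₁ k₂ : ℝ → ℝ}

theorem continuous (h : HasC2Derivs g g₁ g₂) : Continuous g :=
  continuous_iff_continuousAt.2 fun x => (h.hasDerivAt x).continuousAt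

theorem continuous_fst (h : HasC2Derivs g g₁ g₂) : Continuous g₁ :=
  continuous_iff_continuousAt.2 fun x => (h.hasDerivAt' x).continuousAt

theorem add (h : HasC2Derivs g g₁ g₂) (h' : HasC2Derivs k k₁ k₂) :
    HasC2Derivs (fun x => g x + k x) (fun x => g₁ x + k₁ x) (fun x => g₂ x + k₂ x) :=
  ⟨fun x => (h.hasDerivAt x).add (h'.hasDerivAt x),
    fun x => (h.hasDerivAt' x).add (h'.hasDerivAt' x), h.continuous_snd.add h'.continuous_snd⟩

theorem sub (h : HasC2Derivs g g₁ g₂) (h' : HasC2Derivs k k₁ k₂) :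
    HasC2Derivs (fun x => g x - k x) (fun x => g₁ x - k₁ x) (fun x => g₂ x - k₂ x) :=
  ⟨fun x => (h.hasDerivAt x).sub (h'.hasDerivAt x),
    fun x => (h.hasDerivAt' x).sub (h'.hasDerivAt' x), h.continuous_snd.sub h'.continuous_snd⟩

theorem const_mul (c : ℝ) (h : HasC2Derivs g g₁ g₂) :
    HasC2Derivs (fun x => c * g x) (fun x => c * g₁ x) (fun x => c * g₂ x) :=
  ⟨fun x => (h.hasDerivAt x).const_mul c, fun x => (h.hasDerivAt' x).const_mul c,
    h.continuous_snd.const_mul c⟩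

theorem comp_add_const (h : HasC2Derivs g g₁ g₂) (c : ℝ) :
    HasC2Derivs (fun x => g (x + c)) (fun x => g₁ (x + c)) (fun x => g₂ (x + c)) :=
  ⟨fun x => (h.hasDerivAt (x + c)).comp_add_const x c,
    fun x => (h.hasDerivAt' (x + c)).comp_add_const x c, h.continuous_snd.comp (by fun_prop)⟩

theorem mul (h : HasC2Derivs g g₁ g₂) (h' : HasC2Derivs k k₁ k₂) :
    HasC2Derivs (fun x => g x * k x) (fun x => g₁ x * k x + g x * k₁ x)
      (fun x => g₂ x * k x + 2 * (g₁ x * k₁ x) + g x * k₂ x) := by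
  refine ⟨fun x => (h.hasDerivAt x).mul (h'.hasDerivAt x), fun x => ?_, ?_⟩
  · have := ((h.hasDerivAt' x).mul (h'.hasDerivAt x)).add
      ((h.hasDerivAt x).mul (h'.hasDerivAt' x))
    exact this.congr_deriv (by ring)
  · have := h.continuous; have := h.continuous_fst; have := h.continuous_snd
    have := h'.continuous; have := h'.continuous_fst; have := h'.continuous_snd
    fun_prop

theorem abs_fst_sub_le (h : HasC2Derivs g g₁ g₂) {a b x y : ℝ} (hx : x ∈ Icc a b)
    (hy : y ∈ Icc a b) : |g₁ x - g₁ y| ≤ ∫ t in a..b, |g₂ t| := by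
  have hab : a ≤ b := hx.1.trans hx.2
  have hc := h.continuous_snd
  rw [← intervalIntegral.integral_eq_sub_of_hasDerivAt (fun t _ => h.hasDerivAt' t)
    (hc.intervalIntegrable _ _)]
  rw [intervalIntegral.integral_of_le hab]
  refine (intervalIntegral.norm_integral_le_integral_norm_uIoc (f := g₂)).trans ?_
  refine setIntegral_mono_set ((hc.abs.intervalIntegrable a b).1) ?_ ?_
  · exact Eventually.of_forall fun t => abs_nonneg _
  · refine LE.le.eventuallyLE fun t ht => ?_
    rw [mem_uIoc] at ht
    rcases ht with ht | ht
    · exact ⟨hy.1.trans_lt ht.1, ht.2.trans hx.2⟩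
    · exact ⟨hx.1.trans_lt ht.1, ht.2.trans hy.2⟩

end HasC2Derivs

/-- Some value of `|g|` on `[c, d]` is at most the average of `|g|` there, hence is controlled by
the integral over the larger interval `[a, b]`. -/
theorem exists_abs_mul_le_integral {g : ℝ → ℝ} (hg : Continuous g) {a b c d : ℝ} (hac : a ≤ c)
    (hcd : c ≤ d) (hdb : d ≤ b) : ∃ y ∈ Icc c d, |g y| * (d - c) ≤ ∫ t in a..b, |g t| := by
  obtain ⟨y, hy, hmin⟩ := isCompact_Icc.exists_isMinOn (nonempty_Icc.2 hcd) hg.abs.continuousOn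
  refine ⟨y, hy, ?_⟩
  calc |g y| * (d - c) = ∫ _ in c..d, |g y| := by simp [mul_comm]
    _ ≤ ∫ t in c..d, |g t| := by
        refine intervalIntegral.integral_mono_on hcd (by simp) (hg.abs.intervalIntegrable _ _) ?_
        exact fun t ht => hmin ht
    _ ≤ ∫ t in a..b, |g t| := by
        refine intervalIntegral.integral_mono_interval hac hcd hdb ?_
          (hg.abs.intervalIntegrable _ _)
        exact Eventually.of_forall fun t => abs_nonneg _

/-- Landau's inequality: the mean value theorem between points of the two outer thirds, where `g`
is at most its mean, bounds `g₁` at one point; `g₂` controls the oscillation of `g₁`. -/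
theorem HasC2Derivs.abs_le_integral {g g₁ g₂ : ℝ → ℝ} (h : HasC2Derivs g g₁ g₂) {a b : ℝ}
    (hab : a < b) (hL : b - a ≤ 1) {x : ℝ} (hx : x ∈ Icc a b) :
    |g x| ≤ 21 / (b - a) ^ 2 * ((∫ t in a..b, |g t|) + ∫ t in a..b, |g₂ t|) ∧
    |g₁ x| ≤ 21 / (b - a) ^ 2 * ((∫ t in a..b, |g t|) + ∫ t in a..b, |g₂ t|) := by
  set L := b - a with hLdef
  have hL0 : 0 < L := by simp only [hLdef]; linarith
  set I := ∫ t in a..b, |g t|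
  set J := ∫ t in a..b, |g₂ t|
  have hI : 0 ≤ I := intervalIntegral.integral_nonneg hab.le fun t _ => abs_nonneg _
  have hJ : 0 ≤ J := intervalIntegral.integral_nonneg hab.le fun t _ => abs_nonneg _
  obtain ⟨y, hy, hyI⟩ := exists_abs_mul_le_integral h.continuous (a := a) (b := b) (c := a)
    (d := a + L / 3) le_rfl (by linarith) (by linarith)
  obtain ⟨z, hz, hzI⟩ := exists_abs_mul_le_integral h.continuous (a := a) (b := b) (c := b - L / 3)
    (d := b) (by linarith) (by linarith) le_rfl
  have hy' : |g y| ≤ 3 * I / L := by rw [le_div_iff₀ hL0]; linarith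
  have hz' : |g z| ≤ 3 * I / L := by rw [le_div_iff₀ hL0]; linarith
  have hyz : L / 3 ≤ z - y := by linarith [hy.2, hz.1]
  obtain ⟨c, hc, hgc⟩ := exists_hasDerivAt_eq_slope g g₁ (by linarith : y < z)
    h.continuous.continuousOn fun t _ => h.hasDerivAt t
  have hcab : c ∈ Icc a b := ⟨by linarith [hy.1, hc.1], by linarith [hz.2, hc.2]⟩
  have hg1c : |g₁ c| ≤ 18 * I / L ^ 2 := by
    rw [hgc, abs_div, abs_of_pos (by linarith : 0 < z - y)]
    calc |g z - g y| / (z - y) ≤ (3 * I / L + 3 * I / L) / (L / 3) := by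
          gcongr
          exact (abs_sub _ _).trans (add_le_add hz' hy')
      _ = 18 * I / L ^ 2 := by field_simp; ring
  have hg1 : ∀ w ∈ Icc a b, |g₁ w| ≤ 18 * I / L ^ 2 + J := by
    intro w hw
    have := h.abs_fst_sub_le hw hcab
    have h2 := abs_sub_abs_le_abs_sub (g₁ w) (g₁ c)
    linarith
  have hL1 : 1 ≤ 1 / L ^ 2 := by
    rw [le_div_iff₀ (by positivity), one_mul]; exact pow_le_one₀ hL0.le hL
  have hLI : I / L ≤ I / L ^ 2 := by
    gcongr; nlinarith
  have hJ2 : J ≤ J / L ^ 2 := by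
    calc J = J * 1 := by ring
      _ ≤ J * (1 / L ^ 2) := by gcongr
      _ = J / L ^ 2 := by ring
  have hI2 : 0 ≤ I / L ^ 2 := by positivity
  have e : 21 / L ^ 2 * (I + J) = 21 * (I / L ^ 2) + 21 * (J / L ^ 2) := by ring
  have e1 : 18 * I / L ^ 2 = 18 * (I / L ^ 2) := by ring
  have e2 : 3 * I / L = 3 * (I / L) := by ring
  refine ⟨?_, ?_⟩
  · have hdiff : |g x - g y| ≤ (18 * I / L ^ 2 + J) * |x - y| := by
      have := (convex_Icc a b).norm_image_sub_le_of_norm_hasDerivWithin_le (f := g) (f' := g₁)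
        (fun w _ => (h.hasDerivAt w).hasDerivWithinAt) hg1
        (⟨hy.1, by linarith [hy.2]⟩ : y ∈ Icc a b) hx
      simpa using this
    have hxy : |x - y| ≤ 1 := abs_le.2 ⟨by linarith [hx.1, hy.2], by linarith [hx.2, hy.1]⟩
    have h3 : (18 * I / L ^ 2 + J) * |x - y| ≤ 18 * I / L ^ 2 + J := by
      have : 0 ≤ 18 * I / L ^ 2 + J := by positivity
      nlinarith
    have h2 := abs_sub_abs_le_abs_sub (g x) (g y)
    rw [e]; linarith
  · have := hg1 x hx
    rw [e]; linarith

theorem eLpNorm_one_le_of_measure_univ_le_one {α : Type*} [MeasurableSpace α] {μ : Measure α}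
    (hμ : μ univ ≤ 1) {p : ℝ≥0∞} (hp : 1 ≤ p) {f : α → ℝ} (hf : AEStronglyMeasurable f μ) :
    eLpNorm f 1 μ ≤ eLpNorm f p μ := by
  refine (eLpNorm_le_eLpNorm_mul_rpow_measure_univ hp hf).trans ?_
  refine mul_le_of_le_one_right' (ENNReal.rpow_le_one hμ ?_)
  rcases eq_or_ne p ∞ with rfl | h
  · simp
  · rw [sub_nonneg]
    have : 1 ≤ p.toReal := by
      rw [← ENNReal.toReal_one]; exact (ENNReal.toReal_le_toReal (by simp) h).2 hp
    simpa using inv_le_one_of_one_le₀ this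

theorem ofReal_integral_abs_eq_eLpNorm {g : ℝ → ℝ} (hg : Continuous g) {a b : ℝ} (hab : a ≤ b) :
    ENNReal.ofReal (∫ t in a..b, |g t|) = eLpNorm g 1 (volume.restrict (Icc a b)) := by
  rw [eLpNorm_one_eq_lintegral_enorm, intervalIntegral.integral_of_le hab,
    ← integral_Icc_eq_integral_Ioc, ofReal_integral_eq_lintegral_ofReal]
  · refine lintegral_congr fun x => ?_
    rw [Real.enorm_eq_ofReal_abs]
  · exact hg.abs.integrableOn_Icc
  · exact Eventually.of_forall fun x => abs_nonneg _

theorem exists_enorm_le_eLpNorm_of_hasC2Derivs {p : ℝ≥0∞} (hp : 1 ≤ p) {a b : ℝ} (hab : a < b)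
    (hL : b - a ≤ 1) :
    ∃ C : ℝ≥0, ∀ g g₁ g₂ : ℝ → ℝ, HasC2Derivs g g₁ g₂ → ∀ x ∈ Icc a b,
      ‖g x‖ₑ ≤ C * (eLpNorm g p (volume.restrict (Icc a b))
        + eLpNorm g₂ p (volume.restrict (Icc a b))) ∧
      ‖g₁ x‖ₑ ≤ C * (eLpNorm g p (volume.restrict (Icc a b))
        + eLpNorm g₂ p (volume.restrict (Icc a b))) := by
  have hC : 0 ≤ 21 / (b - a) ^ 2 := by positivity
  refine ⟨(21 / (b - a) ^ 2).toNNReal, fun g g₁ g₂ h x hx => ?_⟩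
  have hμ : (volume.restrict (Icc a b)) univ ≤ 1 := by
    rw [Measure.restrict_apply_univ, Real.volume_Icc]
    exact ENNReal.ofReal_le_one.2 hL
  have key : ∀ r : ℝ, |r| ≤ 21 / (b - a) ^ 2 * ((∫ t in a..b, |g t|) + ∫ t in a..b, |g₂ t|) →
      ‖r‖ₑ ≤ (21 / (b - a) ^ 2).toNNReal * (eLpNorm g p (volume.restrict (Icc a b))
        + eLpNorm g₂ p (volume.restrict (Icc a b))) := by
    intro r hr
    rw [Real.enorm_eq_ofReal_abs]
    refine (ENNReal.ofReal_le_ofReal hr).trans ?_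
    rw [ENNReal.ofReal_mul hC, ENNReal.ofReal_add
      (intervalIntegral.integral_nonneg hab.le fun t _ => abs_nonneg _)
      (intervalIntegral.integral_nonneg hab.le fun t _ => abs_nonneg _),
      ofReal_integral_abs_eq_eLpNorm h.continuous hab.le,
      ofReal_integral_abs_eq_eLpNorm h.continuous_snd hab.le]
    refine mul_le_mul' le_rfl (add_le_add ?_ ?_)
    · exact eLpNorm_one_le_of_measure_univ_le_one hμ hp h.continuous.aestronglyMeasurable
    · exact eLpNorm_one_le_of_measure_univ_le_one hμ hp h.continuous_snd.aestronglyMeasurable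
  exact ⟨key _ (h.abs_le_integral hab hL hx).1, key _ (h.abs_le_integral hab hL hx).2⟩

/-- Taylor's formula, with the remainder measured by the maximal function of `|g₂|`. -/
theorem HasC2Derivs.abs_sub_le {g g₁ g₂ : ℝ → ℝ} (h : HasC2Derivs g g₁ g₂) (x : ℝ) {t : ℝ}
    (ht : t ∈ Icc (0 : ℝ) 1) :
    |g t - g x| ≤ |g₁ x| * |t - x| + maxAvg (fun u => |g₂ u|) x * (t - x) ^ 2 := by
  have hc := h.continuous_snd.abs
  have hseg := mul_segAvg (fun u => |g₂ u|) x t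
  have hle := segAvg_le_maxAvg hc x ht
  -- the derivative oscillates on the segment between `x` and `t` by at most `∫ |g₂|`
  have hosc : ∀ w ∈ uIcc x t, |g₁ w - g₁ x| ≤ |t - x| * segAvg (fun u => |g₂ u|) x t := by
    intro w hw
    rcases le_total x t with hxt | hxt
    · rw [uIcc_of_le hxt] at hw
      rw [abs_of_nonneg (sub_nonneg.2 hxt), hseg]
      exact h.abs_fst_sub_le hw ⟨le_rfl, hxt⟩
    · rw [uIcc_of_ge hxt] at hw
      rw [abs_of_nonpos (sub_nonpos.2 hxt), neg_mul, hseg, ← intervalIntegral.integral_symm]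
      exact h.abs_fst_sub_le hw ⟨hxt, le_rfl⟩
  have hbound := (convex_uIcc x t).norm_image_sub_le_of_norm_hasDerivWithin_le
    (f := fun w => g w - g₁ x * w) (f' := fun w => g₁ w - g₁ x)
    (fun w _ => ((h.hasDerivAt w).sub
      (by simpa using (hasDerivAt_id w).const_mul (g₁ x))).hasDerivWithinAt) hosc
    left_mem_uIcc right_mem_uIcc
  simp only [Real.norm_eq_abs] at hbound
  have e : g t - g x = g₁ x * (t - x) + (g t - g₁ x * t - (g x - g₁ x * x)) := by ring
  rw [e]
  refine (abs_add_le _ _).trans ?_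
  rw [abs_mul]
  gcongr
  calc _ ≤ |t - x| * segAvg (fun u => |g₂ u|) x t * |t - x| := hbound
    _ ≤ |t - x| * maxAvg (fun u => |g₂ u|) x * |t - x| := by gcongr
    _ = maxAvg (fun u => |g₂ u|) x * |t - x| ^ 2 := by ring
    _ = _ := by rw [sq_abs]

/-! ### Sublinear monotone operators on `L_p([0,1])` -/

theorem coeFn_contLp (p : ℝ≥0∞) {u : ℝ → ℝ} (hu : Continuous u) : contLp p u hu =ᵐ[leb01] u :=
  (memLp_of_continuous01 p hu).coeFn_toLp

namespace IsSublinearOp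

variable {p : ℝ≥0∞} {T : Lp01 p → Lp01 p}

theorem map_zero (hT : IsSublinearOp T) : T 0 = 0 := by
  simpa using hT.2 0 0 le_rfl

theorem neg_le (hT : IsSublinearOp T) (f : Lp01 p) : -T f ≤ T (-f) := by
  have h := hT.1 f (-f)
  rw [add_neg_cancel, hT.map_zero] at h
  exact neg_le_iff_add_nonneg'.2 h

theorem abs_sub_le (hT : IsSublinearOp T) (hm : Monotone T) (f g : Lp01 p) :
    |T f - T g| ≤ T |f - g| := by
  have key : ∀ f g : Lp01 p, T f - T g ≤ T |f - g| := by
    intro f g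
    have h1 : T f ≤ T (f - g) + T g := by simpa using hT.1 (f - g) g
    exact (sub_le_iff_le_add.2 h1).trans (hm (le_abs_self _))
  refine abs_le'.2 ⟨key f g, ?_⟩
  rw [neg_sub, abs_sub_comm]
  exact key g f

theorem norm_sub_le [Fact (1 ≤ p)] (hT : IsSublinearOp T) (hm : Monotone T) {R : ℝ}
    (hR : ∀ f, ‖T f‖ ≤ R * ‖f‖) (f g : Lp01 p) : ‖T f - T g‖ ≤ R * ‖f - g‖ := by
  have h1 : ‖T f - T g‖ ≤ ‖T |f - g|‖ :=
    norm_le_norm_of_abs_le_abs ((hT.abs_sub_le hm f g).trans (le_abs_self _))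
  refine h1.trans ((hR _).trans_eq ?_)
  rw [norm_abs_eq_norm]

/-- Strong translatability allows to compare `T u` with the constant `u q` times `T 1`. -/
theorem abs_op_contLp_sub_le (hT : IsSublinearOp T) (hm : Monotone T)
    (htr : IsStronglyTranslatable T) {u : ℝ → ℝ} (hu : Continuous u) {q A B : ℝ} (hA : 0 ≤ A)
    (hB : 0 ≤ B) (h : ∀ t ∈ Icc (0 : ℝ) 1, |u t - u q| ≤ A * |t - q| + B * (t - q) ^ 2) :
    ∀ᵐ s ∂leb01, |T (contLp p u hu) s - u q * T (eZero p) s|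
      ≤ A * T (absShift p q) s + B * T (sqShift p q) s := by
  set w : Lp01 p := contLp p u hu + (-u q) • eZero p with hw
  set z : Lp01 p := A • absShift p q + B • sqShift p q with hz
  have hwz : w ≤ z ∧ -w ≤ z := by
    have hpt : ∀ᵐ s ∂leb01, |w s| ≤ z s := by
      filter_upwards [Lp.coeFn_add (contLp p u hu) ((-u q) • eZero p),
        Lp.coeFn_smul (-u q) (eZero p), coeFn_contLp p hu,
        coeFn_contLp p (continuous_const : Continuous fun _ : ℝ => (1 : ℝ)),
        Lp.coeFn_add (A • absShift p q) (B • sqShift p q), Lp.coeFn_smul A (absShift p q),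
        Lp.coeFn_smul B (sqShift p q),
        coeFn_contLp p (by fun_prop : Continuous fun t : ℝ => |t - q|),
        coeFn_contLp p (by fun_prop : Continuous fun t : ℝ => (t - q) ^ 2),
        ae_restrict_mem measurableSet_Icc] with s h1 h2 h3 h4 h5 h6 h7 h8 h9 hs
      rw [hw, h1, Pi.add_apply, h2, Pi.smul_apply, h3, eZero, h4, hz, h5, Pi.add_apply, h6, h7,
        Pi.smul_apply, Pi.smul_apply, absShift, sqShift, h8, h9]
      have := h s hs
      simp only [smul_eq_mul, mul_one]
      exact this
    constructor
    · rw [← Lp.coeFn_le]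
      filter_upwards [hpt] with s hs using (le_abs_self _).trans hs
    · rw [← Lp.coeFn_le]
      filter_upwards [hpt, Lp.coeFn_neg w] with s hs h1
      rw [h1]
      exact (neg_le_abs _).trans hs
  have hTw : T w = T (contLp p u hu) + (-u q) • T (eZero p) := htr _ _
  have hTz : T z ≤ A • T (absShift p q) + B • T (sqShift p q) := by
    refine (hT.1 _ _).trans_eq ?_
    rw [hT.2 A _ hA, hT.2 B _ hB]
  have h1 : T w ≤ A • T (absShift p q) + B • T (sqShift p q) := (hm hwz.1).trans hTz
  have h2 : -T w ≤ A • T (absShift p q) + B • T (sqShift p q) :=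
    (hT.neg_le w).trans ((hm hwz.2).trans hTz)
  rw [hTw] at h1 h2
  rw [← Lp.coeFn_le] at h1 h2
  filter_upwards [h1, h2, Lp.coeFn_neg (T (contLp p u hu) + (-u q) • T (eZero p)),
    Lp.coeFn_add (T (contLp p u hu)) ((-u q) • T (eZero p)),
    Lp.coeFn_smul (-u q) (T (eZero p)),
    Lp.coeFn_add (A • T (absShift p q)) (B • T (sqShift p q)),
    Lp.coeFn_smul A (T (absShift p q)), Lp.coeFn_smul B (T (sqShift p q))]
    with s h1 h2 e1 e2 e3 e4 e5 e6
  rw [e4, Pi.add_apply, e5, e6, Pi.smul_apply, Pi.smul_apply] at h1 h2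
  rw [e1, Pi.neg_apply] at h2
  rw [e2, Pi.add_apply, e3, Pi.smul_apply] at h1 h2
  simp only [smul_eq_mul] at h1 h2
  exact abs_le'.2 ⟨by linarith, by linarith⟩

/-- The pointwise estimate at the rational points `q`, in the limit `q → s`. -/
theorem ae_abs_op_sub_mul_le (hT : IsSublinearOp T) (hm : Monotone T)
    (htr : IsStronglyTranslatable T) {g g₁ g₂ : ℝ → ℝ} (h : HasC2Derivs g g₁ g₂) :
    ∀ᵐ s ∂leb01, |T (contLp p g h.continuous) s - g s * T (eZero p) s|
      ≤ |g₁ s| * lpDiagonal (fun x => T (absShift p x)) s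
        + maxAvg (fun u => |g₂ u|) s * lpDiagonal (fun x => T (sqShift p x)) s := by
  have hk : Continuous fun u => |g₂ u| := h.continuous_snd.abs
  have hrat : ∀ᵐ s ∂leb01, ∀ q : ℚ, |T (contLp p g h.continuous) s - g q * T (eZero p) s|
      ≤ |g₁ q| * T (absShift p q) s + maxAvg (fun u => |g₂ u|) q * T (sqShift p q) s := by
    rw [ae_all_iff]
    exact fun q => hT.abs_op_contLp_sub_le hm htr h.continuous (abs_nonneg _)
      (maxAvg_nonneg hk (fun _ => abs_nonneg _) _) fun t ht => h.abs_sub_le q ht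
  filter_upwards [hrat, tendsto_lpDiagonal_absShift hT hm, tendsto_lpDiagonal_sqShift hT hm,
    ae_restrict_mem measurableSet_Icc] with s hs h1 h2 hs01
  have := ratNhds01_neBot hs01
  have hq : Tendsto (fun q : ℚ => (q : ℝ)) (ratNhds01 s) (𝓝 s) :=
    tendsto_comap.mono_right nhdsWithin_le_nhds
  refine le_of_tendsto_of_tendsto (f := fun q : ℚ =>
    |T (contLp p g h.continuous) s - g q * T (eZero p) s|) (b := ratNhds01 s) ?_ ?_
    (Eventually.of_forall hs)
  · exact ((((h.continuous.tendsto s).comp hq).mul_const _).const_sub _).abs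
  · exact (((h.continuous_fst.abs.tendsto s).comp hq).mul h1).add
      ((((continuous_maxAvg hk).tendsto s).comp hq).mul h2)

end IsSublinearOp

theorem tParam_sq {p : ℝ≥0∞} (T : Lp01 p → Lp01 p) :
    tParam T ^ 2 = max (max (‖T (eZero p) - eZero p‖ₑ)
      (eLpNorm (lpDiagonal fun x => T (absShift p x)) p leb01))
      (eLpNorm (lpDiagonal fun x => T (sqShift p x)) ∞ leb01) := by
  rw [tParam, ← ENNReal.rpow_natCast, ← ENNReal.rpow_mul]
  norm_num

theorem eLpNorm_ne_top_of_continuous {p : ℝ≥0∞} {u : ℝ → ℝ} (hu : Continuous u) :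
    eLpNorm u p leb01 ≠ ∞ := (memLp_of_continuous01 p hu).eLpNorm_ne_top

/-- The approximation error of an operator on `C²` functions. -/
theorem exists_enorm_op_contLp_sub_le {p : ℝ≥0∞} (hp : 1 < p) (hp' : p < ∞) :
    ∃ C : ℝ≥0, ∀ T : Lp01 p → Lp01 p, IsSublinearOp T → Monotone T → IsStronglyTranslatable T →
      tParam T ≠ ∞ → ∀ (g g₁ g₂ : ℝ → ℝ) (h : HasC2Derivs g g₁ g₂),
      ‖T (contLp p g h.continuous) - contLp p g h.continuous‖ₑ
        ≤ C * (tParam T ^ 2 * (eLpNorm g p leb01 + eLpNorm g₂ p leb01)) := by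
  obtain ⟨C, hC⟩ := exists_enorm_le_eLpNorm_of_hasC2Derivs hp.le (zero_lt_one (α := ℝ))
    (by norm_num)
  obtain ⟨D, hD⟩ := exists_eLpNorm_maxAvg_le hp hp'
  refine ⟨2 * C + D, fun T hT hm htr htop g g₁ g₂ h => ?_⟩
  have hτ := tParam_sq T
  set τ := tParam T ^ 2 with hτdef
  have hτtop : τ ≠ ∞ := ENNReal.pow_ne_top htop
  have hτ0 : ‖T (eZero p) - eZero p‖ₑ ≤ τ := by
    rw [hτ]; exact (le_max_left _ _).trans (le_max_left _ _)
  have hτ1 : eLpNorm (lpDiagonal fun x => T (absShift p x)) p leb01 ≤ τ := by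
    rw [hτ]; exact (le_max_right _ _).trans (le_max_left _ _)
  have hτ2 : eLpNorm (lpDiagonal fun x => T (sqShift p x)) ∞ leb01 ≤ τ := by
    rw [hτ]; exact le_max_right _ _
  set N := eLpNorm g p leb01 + eLpNorm g₂ p leb01 with hN
  have hNtop : C * N ≠ ∞ := ENNReal.mul_ne_top ENNReal.coe_ne_top
    (ENNReal.add_ne_top.2 ⟨eLpNorm_ne_top_of_continuous h.continuous,
      eLpNorm_ne_top_of_continuous h.continuous_snd⟩)
  set G := (C * N).toReal with hG
  have hG0 : 0 ≤ G := ENNReal.toReal_nonneg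
  have hGof : ENNReal.ofReal G = C * N := ENNReal.ofReal_toReal hNtop
  have hle : ∀ r : ℝ, ‖r‖ₑ ≤ C * N → |r| ≤ G := by
    intro r hr
    rw [Real.enorm_eq_ofReal_abs] at hr
    exact (ENNReal.ofReal_le_iff_le_toReal hNtop).1 hr
  have hsup : ∀ x ∈ Icc (0 : ℝ) 1, |g x| ≤ G ∧ |g₁ x| ≤ G := fun x hx =>
    ⟨hle _ (hC g g₁ g₂ h x hx).1, hle _ (hC g g₁ g₂ h x hx).2⟩
  set c := τ.toReal with hc
  have hcof : ENNReal.ofReal c = τ := ENNReal.ofReal_toReal hτtop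
  have hk : Continuous fun u => |g₂ u| := h.continuous_snd.abs
  set m := maxAvg fun u => |g₂ u| with hmdef
  have hm0 : ∀ x, 0 ≤ m x := maxAvg_nonneg hk fun _ => abs_nonneg _
  have hmc : Continuous m := continuous_maxAvg hk
  set F := T (contLp p g h.continuous) - contLp p g h.continuous with hF
  set E := T (eZero p) - eZero p with hE
  set D₁ := lpDiagonal fun x => T (absShift p x) with hD₁
  have hmain : ∀ᵐ s ∂leb01, |F s| - (c * m s + G * |E s|) ≤ G * |D₁ s| := by
    filter_upwards [hT.ae_abs_op_sub_mul_le hm htr h, ae_restrict_mem measurableSet_Icc,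
      Lp.coeFn_sub (T (contLp p g h.continuous)) (contLp p g h.continuous),
      Lp.coeFn_sub (T (eZero p)) (eZero p), coeFn_contLp p h.continuous,
      coeFn_contLp p (continuous_const : Continuous fun _ : ℝ => (1 : ℝ)),
      ae_le_eLpNormEssSup (f := lpDiagonal fun x => T (sqShift p x)) (μ := leb01)]
      with s hs hs01 e1 e2 e3 e4 hess
    have hd2 : lpDiagonal (fun x => T (sqShift p x)) s ≤ c := by
      rw [← eLpNorm_exponent_top, Real.enorm_eq_ofReal_abs] at hess
      exact (le_abs_self _).trans
        ((ENNReal.ofReal_le_iff_le_toReal hτtop).1 (hess.trans hτ2))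
    have eE : E s = T (eZero p) s - 1 := by rw [hE, e2, Pi.sub_apply, eZero, e4]
    have eF : F s = (T (contLp p g h.continuous) s - g s * T (eZero p) s) + g s * E s := by
      rw [hF, e1, Pi.sub_apply, e3, eE]; ring
    have h1 : |F s| ≤ |T (contLp p g h.continuous) s - g s * T (eZero p) s| + |g s| * |E s| := by
      rw [eF, ← abs_mul]; exact abs_add_le _ _
    have h2 : |g s| * |E s| ≤ G * |E s| := by gcongr; exact (hsup s hs01).1
    have h3 : |g₁ s| * D₁ s ≤ G * |D₁ s| :=
      (mul_le_mul_of_nonneg_left (le_abs_self _) (abs_nonneg _)).trans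
        (mul_le_mul_of_nonneg_right (hsup s hs01).2 (abs_nonneg _))
    have h4 : m s * lpDiagonal (fun x => T (sqShift p x)) s ≤ c * m s := by
      rw [mul_comm]; exact mul_le_mul_of_nonneg_right hd2 (hm0 s)
    linarith
  -- `D₁` is not known to be measurable; `V` is a measurable function below `G * |D₁|`
  set V : ℝ → ℝ := fun s => max (|F s| - (c * m s + G * |E s|)) 0 with hV
  have hFm : AEStronglyMeasurable F leb01 := Lp.aestronglyMeasurable F
  have hEm : AEStronglyMeasurable E leb01 := Lp.aestronglyMeasurable E
  have hmm : AEStronglyMeasurable m leb01 := hmc.aestronglyMeasurable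
  have hbm : AEStronglyMeasurable (fun s => c * m s + G * |E s|) leb01 :=
    (hmm.const_mul c).add (hEm.norm.const_mul G)
  have hVm : AEStronglyMeasurable V leb01 :=
    (hFm.norm.sub hbm).sup aestronglyMeasurable_const
  have hV1 : eLpNorm V p leb01 ≤ C * N * τ := by
    calc eLpNorm V p leb01 ≤ ENNReal.ofReal G * eLpNorm D₁ p leb01 := by
          refine eLpNorm_le_mul_eLpNorm_of_ae_le_mul ?_ p
          filter_upwards [hmain] with s hs
          rw [Real.norm_eq_abs, Real.norm_eq_abs, abs_of_nonneg (le_max_right _ _)]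
          exact max_le hs (by positivity)
      _ ≤ C * N * τ := by rw [hGof]; gcongr
  have hm1 : eLpNorm (fun s => c * m s) p leb01 ≤ τ * (D * eLpNorm g₂ p leb01) := by
    calc eLpNorm (fun s => c * m s) p leb01 ≤ ENNReal.ofReal c * eLpNorm m p leb01 := by
          refine eLpNorm_le_mul_eLpNorm_of_ae_le_mul (Eventually.of_forall fun s => ?_) p
          rw [norm_mul, Real.norm_of_nonneg (ENNReal.toReal_nonneg : 0 ≤ c)]
      _ ≤ τ * (D * eLpNorm (fun u => |g₂ u|) p leb01) := by
          rw [hcof]; gcongr; exact hD _ hk fun _ => abs_nonneg _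
      _ = _ := by
          congr 2
          exact eLpNorm_norm g₂
  have hE1 : eLpNorm (fun s => G * |E s|) p leb01 ≤ C * N * τ := by
    calc eLpNorm (fun s => G * |E s|) p leb01 ≤ ENNReal.ofReal G * eLpNorm E p leb01 := by
          refine eLpNorm_le_mul_eLpNorm_of_ae_le_mul (Eventually.of_forall fun s => ?_) p
          rw [norm_mul, Real.norm_of_nonneg hG0, Real.norm_eq_abs, abs_abs, Real.norm_eq_abs]
      _ ≤ C * N * τ := by
          rw [hGof]; gcongr
          rwa [← Lp.enorm_def]
  calc ‖F‖ₑ = eLpNorm F p leb01 := Lp.enorm_def F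
    _ ≤ eLpNorm (V + fun s => c * m s + G * |E s|) p leb01 := by
        refine eLpNorm_mono_real fun s => ?_
        rw [Real.norm_eq_abs, Pi.add_apply]
        have : |F s| - (c * m s + G * |E s|) ≤ V s := le_max_left _ _
        linarith
    _ ≤ eLpNorm V p leb01 + eLpNorm (fun s => c * m s + G * |E s|) p leb01 :=
        eLpNorm_add_le hVm hbm hp.le
    _ ≤ eLpNorm V p leb01 + (eLpNorm (fun s => c * m s) p leb01
          + eLpNorm (fun s => G * |E s|) p leb01) := by
        gcongr
        exact eLpNorm_add_le (hmm.const_mul c) (hEm.norm.const_mul G) hp.le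
    _ ≤ C * N * τ + (τ * (D * N) + C * N * τ) := by
        gcongr
        refine hm1.trans ?_
        gcongr
        exact le_add_self
    _ = _ := by push_cast; ring

/-! ### Second differences and the modulus of smoothness -/

theorem rDiff_two (h : ℝ) (f : ℝ → ℝ) (x : ℝ) :
    rDiff 2 h f x = f (x + 2 * h) - 2 * f (x + h) + f x := by
  simp only [rDiff, Finset.sum_range_succ, Finset.sum_range_zero]
  norm_num
  ring

theorem continuous_uncurry_rDiff_two {f : ℝ → ℝ} (hf : Continuous f) :
    Continuous fun z : ℝ × ℝ => rDiff 2 z.1 f z.2 := by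
  simp only [rDiff_two]
  fun_prop

theorem eLpNorm_rDiff_two_le_omegaMod {p : ℝ≥0∞} (f : ℝ → ℝ) {s : ℝ} {δ : ℝ≥0∞} {S : Set ℝ}
    (hs : ENNReal.ofReal |s| ≤ δ) (hS : ∀ x ∈ S, x ∈ Icc (0 : ℝ) 1 ∧ x + 2 * s ∈ Icc (0 : ℝ) 1) :
    eLpNorm (rDiff 2 s f) p (volume.restrict S) ≤ omegaMod 2 p f δ := by
  refine (eLpNorm_mono_measure _ (Measure.restrict_mono ?_ le_rfl)).trans
    (le_iSup₂_of_le (f := fun h (_ : ENNReal.ofReal |h| ≤ δ) => eLpNorm (rDiff 2 h f) p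
      (volume.restrict {x : ℝ | x ∈ Icc (0 : ℝ) 1 ∧ x + ((2 : ℕ) : ℝ) * h ∈ Icc (0 : ℝ) 1}))
      s hs le_rfl)
  intro x hx
  simpa using hS x hx

/-- Minkowski's integral inequality for an average of functions: by Jensen's inequality, the
`L_p` norm of an average is at most any common bound of the norms. -/
theorem eLpNorm_integral_le_of_forall_le {α β : Type*} [MeasurableSpace α] [MeasurableSpace β]
    {ν : Measure α} [IsProbabilityMeasure ν] {μ : Measure β} [SFinite μ] {p : ℝ≥0∞} (hp : 1 ≤ p)
    (hp' : p ≠ ∞) {Φ : α → β → ℝ} (hΦ : Measurable (Function.uncurry Φ)) {W : ℝ≥0∞}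
    (hW : ∀ᵐ a ∂ν, eLpNorm (Φ a) p μ ≤ W) :
    eLpNorm (fun x => ∫ a, Φ a x ∂ν) p μ ≤ W := by
  have hp0 : p ≠ 0 := (zero_lt_one.trans_le hp).ne'
  have hpr : 0 < p.toReal := ENNReal.toReal_pos hp0 hp'
  have hpow : Measurable (Function.uncurry fun x a => ‖Φ a x‖ₑ ^ p.toReal) :=
    ((hΦ.comp measurable_swap).enorm.pow_const _)
  have hpt : ∀ x, ‖∫ a, Φ a x ∂ν‖ₑ ^ p.toReal ≤ ∫⁻ a, ‖Φ a x‖ₑ ^ p.toReal ∂ν := by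
    intro x
    have hm : AEStronglyMeasurable (fun a => Φ a x) ν :=
      (hΦ.comp measurable_prodMk_right).aestronglyMeasurable
    have h1 : ‖∫ a, Φ a x ∂ν‖ₑ ≤ eLpNorm (fun a => Φ a x) p ν := by
      refine (enorm_integral_le_lintegral_enorm _).trans ?_
      rw [← eLpNorm_one_eq_lintegral_enorm]
      exact eLpNorm_le_eLpNorm_of_exponent_le hp hm
    rw [eLpNorm_eq_lintegral_rpow_enorm_toReal hp0 hp', one_div] at h1
    exact (ENNReal.le_rpow_inv_iff hpr).1 h1
  rw [eLpNorm_eq_lintegral_rpow_enorm_toReal hp0 hp', one_div, ENNReal.rpow_inv_le_iff hpr]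
  calc ∫⁻ x, ‖∫ a, Φ a x ∂ν‖ₑ ^ p.toReal ∂μ ≤ ∫⁻ x, ∫⁻ a, ‖Φ a x‖ₑ ^ p.toReal ∂ν ∂μ :=
        lintegral_mono hpt
    _ = ∫⁻ a, ∫⁻ x, ‖Φ a x‖ₑ ^ p.toReal ∂μ ∂ν := lintegral_lintegral_swap hpow.aemeasurable
    _ ≤ ∫⁻ _, W ^ p.toReal ∂ν := by
        refine lintegral_mono_ae ?_
        filter_upwards [hW] with a ha
        rw [eLpNorm_eq_lintegral_rpow_enorm_toReal hp0 hp', one_div,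
          ENNReal.rpow_inv_le_iff hpr] at ha
        exact ha
    _ = W ^ p.toReal := by simp

/-! ### Steklov means -/

instance isProbabilityMeasure_leb01 : IsProbabilityMeasure leb01 :=
  ⟨by rw [Measure.restrict_apply_univ, Real.volume_Icc]; simp⟩

theorem integral_leb01 (u : ℝ → ℝ) : ∫ t, u t ∂leb01 = ∫ t in (0 : ℝ)..1, u t := by
  rw [intervalIntegral.integral_of_le zero_le_one, integral_Icc_eq_integral_Ioc]

theorem integrable_leb01_prod {u : ℝ × ℝ → ℝ} (hu : Continuous u) :
    Integrable u (leb01.prod leb01) := by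
  rw [Measure.prod_restrict]
  exact hu.continuousOn.integrableOn_compact (isCompact_Icc.prod isCompact_Icc)

theorem exists_hasC2Derivs_antideriv {f : ℝ → ℝ} (hf : Continuous f) :
    ∃ F F₁ : ℝ → ℝ, HasC2Derivs F F₁ f := by
  have h1 : ∀ x, HasDerivAt (fun x => ∫ t in (0 : ℝ)..x, f t) (f x) x := fun x =>
    (hf.integral_hasStrictDerivAt 0 x).hasDerivAt
  have hc : Continuous fun x => ∫ t in (0 : ℝ)..x, f t :=
    continuous_iff_continuousAt.2 fun x => (h1 x).continuousAt
  exact ⟨_, _, fun x => (hc.integral_hasStrictDerivAt 0 x).hasDerivAt, h1, hf⟩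

/-- The double average of `f` over the steps `c * (a + b)` is a second divided difference of a
second antiderivative. -/
theorem HasC2Derivs.integral_comp_add {F F₁ f : ℝ → ℝ} (h : HasC2Derivs F F₁ f) {c : ℝ}
    (hc : c ≠ 0) (x : ℝ) :
    ∫ z : ℝ × ℝ, f (x + c * (z.1 + z.2)) ∂(leb01.prod leb01) = (c ^ 2)⁻¹ * rDiff 2 c F x := by
  have hf := h.continuous_snd
  have hF1 := h.continuous_fst
  have hinner : ∀ a, ∫ b in (0 : ℝ)..1, f (x + c * (a + b))
      = c⁻¹ * (F₁ (x + c + c * a) - F₁ (x + c * a)) := by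
    intro a
    have hd : ∀ b ∈ uIcc (0 : ℝ) 1, HasDerivAt (fun b => c⁻¹ * F₁ (x + c * (a + b)))
        (f (x + c * (a + b))) b := by
      intro b _
      have h0 : HasDerivAt (fun b => x + c * (a + b)) c b := by
        simpa using (((hasDerivAt_id b).const_add a).const_mul c).const_add x
      refine (((h.hasDerivAt' _).comp b h0).const_mul c⁻¹).congr_deriv ?_
      field_simp
    rw [intervalIntegral.integral_eq_sub_of_hasDerivAt hd
      ((by fun_prop : Continuous fun b => f (x + c * (a + b))).intervalIntegrable _ _),
      ← mul_sub]
    congr 3 <;> ring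
  have houter : ∀ y, ∫ a in (0 : ℝ)..1, F₁ (y + c * a) = c⁻¹ * (F (y + c) - F y) := by
    intro y
    have hd : ∀ a ∈ uIcc (0 : ℝ) 1, HasDerivAt (fun a => c⁻¹ * F (y + c * a))
        (F₁ (y + c * a)) a := by
      intro a _
      have h0 : HasDerivAt (fun a => y + c * a) c a := by
        simpa using ((hasDerivAt_id a).const_mul c).const_add y
      refine (((h.hasDerivAt _).comp a h0).const_mul c⁻¹).congr_deriv ?_
      field_simp
    rw [intervalIntegral.integral_eq_sub_of_hasDerivAt hd
      ((by fun_prop : Continuous fun a => F₁ (y + c * a)).intervalIntegrable _ _), ← mul_sub]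
    simp
  rw [integral_prod _ (integrable_leb01_prod (by fun_prop))]
  simp_rw [integral_leb01, hinner]
  rw [intervalIntegral.integral_const_mul, intervalIntegral.integral_sub
    ((by fun_prop : Continuous fun a => F₁ (x + c + c * a)).intervalIntegrable _ _)
    ((by fun_prop : Continuous fun a => F₁ (x + c * a)).intervalIntegrable _ _), houter, houter,
    rDiff_two]
  have e : x + c + c = x + 2 * c := by ring
  rw [e]
  field_simp
  ring

/-- A combination of second differences of `φ`. For `φ` a second antiderivative of `f` it is the
Steklov mean of `f` of second order with step `h`, which uses `f` on the segment from `x` to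
`x + 4 * h` only; the step may be negative. -/
noncomputable def steklov (h : ℝ) (φ : ℝ → ℝ) (x : ℝ) : ℝ :=
  (h ^ 2)⁻¹ * (2 * rDiff 2 h φ x - 1 / 4 * rDiff 2 (2 * h) φ x)

theorem HasC2Derivs.rDiff_two {F F₁ f : ℝ → ℝ} (hF : HasC2Derivs F F₁ f) (h : ℝ) :
    HasC2Derivs (rDiff 2 h F) (rDiff 2 h F₁) (rDiff 2 h f) := by
  have e : ∀ φ : ℝ → ℝ, rDiff 2 h φ = fun x => φ (x + 2 * h) - 2 * φ (x + h) + φ x := fun φ =>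
    funext (_root_.rDiff_two h φ)
  rw [e, e, e]
  exact ((hF.comp_add_const _).sub ((hF.comp_add_const _).const_mul 2)).add hF

theorem HasC2Derivs.steklov {F F₁ f : ℝ → ℝ} (hF : HasC2Derivs F F₁ f) (h : ℝ) :
    HasC2Derivs (steklov h F) (steklov h F₁) (steklov h f) :=
  (((hF.rDiff_two h).const_mul 2).sub ((hF.rDiff_two (2 * h)).const_mul (1 / 4))).const_mul _

theorem HasC2Derivs.sub_steklov_eq {F F₁ f : ℝ → ℝ} (hF : HasC2Derivs F F₁ f) {h : ℝ}
    (hh : h ≠ 0) (x : ℝ) :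
    f x - _root_.steklov h F x
      = ∫ z : ℝ × ℝ, rDiff 2 (h * (z.1 + z.2)) f x ∂(leb01.prod leb01) := by
  have hf := hF.continuous_snd
  have e : ∀ z : ℝ × ℝ, rDiff 2 (h * (z.1 + z.2)) f x
      = f (x + 2 * h * (z.1 + z.2)) - 2 * f (x + h * (z.1 + z.2)) + f x := by
    intro z; rw [_root_.rDiff_two, mul_assoc]
  have i1 := integrable_leb01_prod
    (by fun_prop : Continuous fun z : ℝ × ℝ => f (x + 2 * h * (z.1 + z.2)))
  have i2 := (integrable_leb01_prod
    (by fun_prop : Continuous fun z : ℝ × ℝ => f (x + h * (z.1 + z.2)))).const_mul 2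
  have hsplit : ∫ z : ℝ × ℝ, rDiff 2 (h * (z.1 + z.2)) f x ∂(leb01.prod leb01)
      = ((∫ z : ℝ × ℝ, f (x + 2 * h * (z.1 + z.2)) ∂(leb01.prod leb01))
        - ∫ z : ℝ × ℝ, 2 * f (x + h * (z.1 + z.2)) ∂(leb01.prod leb01))
        + ∫ _ : ℝ × ℝ, f x ∂(leb01.prod leb01) := by
    rw [← integral_sub i1 i2]
    exact (integral_congr_ae (Eventually.of_forall e)).trans
      (integral_add (i1.sub i2) (integrable_const _))
  rw [hsplit, integral_const_mul,
    hF.integral_comp_add (mul_ne_zero two_ne_zero hh), hF.integral_comp_add hh]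
  simp only [_root_.steklov, integral_const, probReal_univ, smul_eq_mul]
  field_simp
  ring

theorem HasC2Derivs.eLpNorm_sub_steklov_le {p : ℝ≥0∞} (hp : 1 ≤ p) (hp' : p ≠ ∞)
    {F F₁ f : ℝ → ℝ} (hF : HasC2Derivs F F₁ f) {h : ℝ} (hh : h ≠ 0) {S : Set ℝ}
    (hS : ∀ x ∈ S, x ∈ Icc (0 : ℝ) 1 ∧ x + 4 * h ∈ Icc (0 : ℝ) 1) :
    eLpNorm (fun x => f x - _root_.steklov h F x) p (volume.restrict S)
      ≤ omegaMod 2 p f (ENNReal.ofReal (2 * |h|)) := by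
  simp_rw [hF.sub_steklov_eq hh]
  refine eLpNorm_integral_le_of_forall_le (Φ := fun z : ℝ × ℝ => rDiff 2 (h * (z.1 + z.2)) f)
    hp hp' ?_ ?_
  · exact ((continuous_uncurry_rDiff_two hF.continuous_snd).comp
      (by fun_prop : Continuous fun y : (ℝ × ℝ) × ℝ => (h * (y.1.1 + y.1.2), y.2))).measurable
  · rw [Measure.prod_restrict]
    filter_upwards [ae_restrict_mem (measurableSet_Icc.prod measurableSet_Icc)] with z hz
    obtain ⟨⟨h1, h2⟩, h3, h4⟩ := hz
    refine eLpNorm_rDiff_two_le_omegaMod f ?_ fun x hx => ⟨(hS x hx).1, ?_⟩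
    · refine ENNReal.ofReal_le_ofReal ?_
      rw [abs_mul, abs_of_nonneg (by linarith : 0 ≤ z.1 + z.2), mul_comm]
      gcongr
      linarith
    · -- the last node is a convex combination of `x` and `x + 4 * h`
      have hconv := (convex_Icc (𝕜 := ℝ) (0 : ℝ) 1) (hS x hx).1 (hS x hx).2
        (a := 1 - (z.1 + z.2) / 2) (b := (z.1 + z.2) / 2) (by linarith) (by linarith) (by ring)
      convert hconv using 1
      simp only [smul_eq_mul]
      ring

theorem eLpNorm_const_mul_real {α : Type*} [MeasurableSpace α] (c : ℝ) (u : α → ℝ) (p : ℝ≥0∞)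
    (μ : Measure α) : eLpNorm (fun x => c * u x) p μ = ‖c‖ₑ * eLpNorm u p μ :=
  eLpNorm_const_smul c u p μ

theorem mul_eLpNorm_steklov_le {p : ℝ≥0∞} (hp : 1 ≤ p) {f : ℝ → ℝ} (hf : Continuous f) {h : ℝ}
    (hh : h ≠ 0) {S : Set ℝ}
    (hS : ∀ x ∈ S, x ∈ Icc (0 : ℝ) 1 ∧ x + 4 * h ∈ Icc (0 : ℝ) 1) :
    ENNReal.ofReal (h ^ 2) * eLpNorm (steklov h f) p (volume.restrict S)
      ≤ 3 * omegaMod 2 p f (ENNReal.ofReal (2 * |h|)) := by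
  set ω := omegaMod 2 p f (ENNReal.ofReal (2 * |h|))
  have hc : ∀ s, Continuous (rDiff 2 s f) := fun s =>
    (continuous_uncurry_rDiff_two hf).comp (by fun_prop : Continuous fun x : ℝ => (s, x))
  have h1 : eLpNorm (rDiff 2 h f) p (volume.restrict S) ≤ ω := by
    refine eLpNorm_rDiff_two_le_omegaMod f (ENNReal.ofReal_le_ofReal ?_) fun x hx =>
      ⟨(hS x hx).1, ?_⟩
    · linarith [abs_nonneg h]
    · have hconv := (convex_Icc (𝕜 := ℝ) (0 : ℝ) 1) (hS x hx).1 (hS x hx).2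
        (a := 1 / 2) (b := 1 / 2) (by norm_num) (by norm_num) (by norm_num)
      convert hconv using 1
      simp only [smul_eq_mul]
      ring
  have h2 : eLpNorm (rDiff 2 (2 * h) f) p (volume.restrict S) ≤ ω := by
    refine eLpNorm_rDiff_two_le_omegaMod f (ENNReal.ofReal_le_ofReal ?_) fun x hx =>
      ⟨(hS x hx).1, ?_⟩
    · rw [abs_mul, abs_two]
    · have := (hS x hx).2
      rwa [show x + 2 * (2 * h) = x + 4 * h by ring]
  have e0 : ENNReal.ofReal (h ^ 2) * ‖(h ^ 2)⁻¹‖ₑ = 1 := by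
    rw [Real.enorm_eq_ofReal (by positivity), ← ENNReal.ofReal_mul (by positivity),
      mul_inv_cancel₀ (by positivity), ENNReal.ofReal_one]
  have e2 : ‖(2 : ℝ)‖ₑ = 2 := by rw [Real.enorm_eq_ofReal (by norm_num)]; norm_num
  have e4 : ‖(1 / 4 : ℝ)‖ₑ ≤ 1 := by
    rw [Real.enorm_eq_ofReal (by norm_num)]; exact ENNReal.ofReal_le_one.2 (by norm_num)
  calc ENNReal.ofReal (h ^ 2) * eLpNorm (steklov h f) p (volume.restrict S)
      = eLpNorm (fun x => 2 * rDiff 2 h f x - 1 / 4 * rDiff 2 (2 * h) f x) p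
          (volume.restrict S) := by
        unfold steklov
        rw [eLpNorm_const_mul_real, ← mul_assoc, e0, one_mul]
    _ ≤ eLpNorm (fun x => 2 * rDiff 2 h f x) p (volume.restrict S)
          + eLpNorm (fun x => 1 / 4 * rDiff 2 (2 * h) f x) p (volume.restrict S) :=
        eLpNorm_sub_le
          ((hc _).const_mul _ : Continuous fun x => 2 * rDiff 2 h f x).aestronglyMeasurable
          ((hc _).const_mul _ : Continuous fun x =>
            1 / 4 * rDiff 2 (2 * h) f x).aestronglyMeasurable hp
    _ ≤ 2 * ω + 1 * ω := by
        rw [eLpNorm_const_mul_real, eLpNorm_const_mul_real, e2]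
        gcongr
    _ = 3 * ω := by ring

/-! ### Smooth approximation controlled by the modulus of smoothness -/

/-- A smooth cutoff passing from `0` to `1` inside `[1/4, 3/4]`. -/
theorem exists_cutoff : ∃ (ψ ψ₁ ψ₂ : ℝ → ℝ) (K : ℝ), HasC2Derivs ψ ψ₁ ψ₂ ∧
    (∀ x, 0 ≤ ψ x ∧ ψ x ≤ 1) ∧ (∀ x ≤ 1 / 4, ψ x = 0 ∧ ψ₁ x = 0 ∧ ψ₂ x = 0) ∧
    (∀ x, 3 / 4 ≤ x → ψ x = 1 ∧ ψ₁ x = 0 ∧ ψ₂ x = 0) ∧ 0 ≤ K ∧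
    ∀ x ∈ Icc (0 : ℝ) 1, |ψ₁ x| ≤ K ∧ |ψ₂ x| ≤ K := by
  set ψ : ℝ → ℝ := fun x => Real.smoothTransition (3 * x - 1) with hψ
  have hs : ContDiff ℝ 2 ψ := Real.smoothTransition.contDiff.comp (by fun_prop)
  have hs1 : ContDiff ℝ 1 (deriv ψ) := hs.deriv' (n := 1)
  have hc2 : Continuous (deriv (deriv ψ)) := hs1.continuous_deriv le_rfl
  have hC2 : HasC2Derivs ψ (deriv ψ) (deriv (deriv ψ)) :=
    ⟨fun x => (hs.differentiable (by norm_num) x).hasDerivAt,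
      fun x => (hs1.differentiable (by norm_num) x).hasDerivAt, hc2⟩
  have hloc : ∀ (c x : ℝ), ψ =ᶠ[𝓝 x] (fun _ => c) →
      ψ x = c ∧ deriv ψ x = 0 ∧ deriv (deriv ψ) x = 0 := by
    intro c x h
    have h1 : deriv ψ =ᶠ[𝓝 x] fun _ => 0 := by
      filter_upwards [h.eventuallyEq_nhds] with y hy
      rw [hy.deriv_eq, deriv_const]
    exact ⟨h.eq_of_nhds, h1.eq_of_nhds, by rw [h1.deriv_eq, deriv_const]⟩
  obtain ⟨K₁, hK₁⟩ := (isCompact_Icc (a := (0 : ℝ)) (b := 1)).exists_bound_of_continuousOn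
    hC2.continuous_fst.continuousOn
  obtain ⟨K₂, hK₂⟩ := (isCompact_Icc (a := (0 : ℝ)) (b := 1)).exists_bound_of_continuousOn
    hc2.continuousOn
  refine ⟨ψ, _, _, max K₁ K₂, hC2, fun x => ⟨Real.smoothTransition.nonneg _,
    Real.smoothTransition.le_one _⟩, fun x hx => hloc 0 x ?_, fun x hx => hloc 1 x ?_, ?_,
    fun x hx => ⟨(hK₁ x hx).trans (le_max_left _ _), (hK₂ x hx).trans (le_max_right _ _)⟩⟩
  · filter_upwards [Iio_mem_nhds (by linarith : x < 1 / 3)] with y hy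
    exact Real.smoothTransition.zero_of_nonpos (by linarith [mem_Iio.1 hy])
  · filter_upwards [Ioi_mem_nhds (by linarith : 2 / 3 < x)] with y hy
    exact Real.smoothTransition.one_of_one_le (by linarith [mem_Ioi.1 hy])
  · exact ((norm_nonneg _).trans (hK₁ 0 (by simp))).trans (le_max_left _ _)

/-- A function on `[0,1]` that is dominated by `v` on `A`, plus `w` on `B`, plus a constant is
controlled by the norms of `v` on `A` and of `w` on `B`. -/
theorem eLpNorm_leb01_le_of_abs_le {p : ℝ≥0∞} (hp : 1 ≤ p) {u v w : ℝ → ℝ} (hv : Continuous v)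
    (hw : Continuous w) {A B : Set ℝ} (hA : MeasurableSet A) (hB : MeasurableSet B)
    {c : ℝ} (hc : 0 ≤ c)
    (h : ∀ x ∈ Icc (0 : ℝ) 1, |u x| ≤ A.indicator (fun x => |v x|) x
      + B.indicator (fun x => |w x|) x + c) :
    eLpNorm u p leb01 ≤ eLpNorm v p (volume.restrict A) + eLpNorm w p (volume.restrict B)
      + ENNReal.ofReal c := by
  have hvm : AEStronglyMeasurable (A.indicator fun x => |v x|) leb01 :=
    (hv.abs.aestronglyMeasurable).indicator hA
  have hwm : AEStronglyMeasurable (B.indicator fun x => |w x|) leb01 :=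
    (hw.abs.aestronglyMeasurable).indicator hB
  have hind : ∀ (S : Set ℝ), MeasurableSet S → ∀ y : ℝ → ℝ,
      eLpNorm (S.indicator fun x => |y x|) p leb01 ≤ eLpNorm y p (volume.restrict S) := by
    intro S hS y
    refine (eLpNorm_mono_measure _ Measure.restrict_le_self).trans ?_
    rw [eLpNorm_indicator_eq_eLpNorm_restrict hS]
    exact (eLpNorm_norm y).le
  calc eLpNorm u p leb01
      ≤ eLpNorm ((A.indicator (fun x => |v x|) + B.indicator (fun x => |w x|))
          + fun _ => c) p leb01 := by
        refine eLpNorm_mono_ae_real ?_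
        filter_upwards [ae_restrict_mem measurableSet_Icc] with x hx using h x hx
    _ ≤ eLpNorm (A.indicator (fun x => |v x|)) p leb01
          + eLpNorm (B.indicator (fun x => |w x|)) p leb01 + eLpNorm (fun _ => c) p leb01 :=
        (eLpNorm_add_le (hvm.add hwm) aestronglyMeasurable_const hp).trans
          (add_le_add_left (eLpNorm_add_le hvm hwm hp) _)
    _ ≤ _ := by
        refine add_le_add (add_le_add (hind A hA v) (hind B hB w)) ?_
        rw [eLpNorm_const _ (zero_lt_one.trans_le hp).ne' (NeZero.ne _), measure_univ,
          ENNReal.one_rpow, mul_one, Real.enorm_eq_ofReal hc]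

/-- The upper estimate of the `K`-functional by the modulus of smoothness. The Steklov mean with
positive step is used on the left part of `[0,1]`, the one with negative step on the right part,
and the two are glued by a cutoff; on the overlap Landau's inequality bounds the derivative of
their difference. -/
theorem exists_hasC2Derivs_approx {p : ℝ≥0∞} (hp : 1 ≤ p) (hp' : p ≠ ∞) :
    ∃ C : ℝ≥0, ∀ f : ℝ → ℝ, Continuous f → ∀ h : ℝ, 0 < h → h ≤ 1 / 16 →
      ∃ g g₁ g₂ : ℝ → ℝ, HasC2Derivs g g₁ g₂ ∧
        eLpNorm (fun x => f x - g x) p leb01 ≤ C * omegaMod 2 p f (ENNReal.ofReal (2 * h)) ∧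
        ENNReal.ofReal (h ^ 2) * eLpNorm g₂ p leb01
          ≤ C * omegaMod 2 p f (ENNReal.ofReal (2 * h)) := by
  obtain ⟨ψ, ψ₁, ψ₂, K, hψ, hψ01, hψl, hψr, hK0, hK⟩ := exists_cutoff
  obtain ⟨D, hD⟩ := exists_enorm_le_eLpNorm_of_hasC2Derivs hp
    (by norm_num : (1 / 4 : ℝ) < 3 / 4) (by norm_num)
  refine ⟨6 + 3 * K.toNNReal * (D * 8), fun f hf h h0 h16 => ?_⟩
  obtain ⟨F, F₁, hF⟩ := exists_hasC2Derivs_antideriv hf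
  set ω := omegaMod 2 p f (ENNReal.ofReal (2 * h)) with hω
  have hl := hF.steklov h
  have hr := hF.steklov (-h)
  have hd := hr.sub hl
  have hS : ∀ x ∈ Icc (0 : ℝ) (3 / 4), x ∈ Icc (0 : ℝ) 1 ∧ x + 4 * h ∈ Icc (0 : ℝ) 1 := by
    rintro x ⟨h1, h2⟩
    refine ⟨⟨h1, by linarith⟩, by linarith, by linarith⟩
  have hS' : ∀ x ∈ Icc (1 / 4 : ℝ) 1, x ∈ Icc (0 : ℝ) 1 ∧ x + 4 * -h ∈ Icc (0 : ℝ) 1 := by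
    rintro x ⟨h1, h2⟩
    refine ⟨⟨by linarith, h2⟩, by linarith, by linarith⟩
  have hl0 := hF.eLpNorm_sub_steklov_le hp hp' h0.ne' hS
  have hr0 := hF.eLpNorm_sub_steklov_le hp hp' (neg_ne_zero.2 h0.ne') hS'
  have hl2 := mul_eLpNorm_steklov_le hp hf h0.ne' hS
  have hr2 := mul_eLpNorm_steklov_le hp hf (neg_ne_zero.2 h0.ne') hS'
  rw [abs_neg] at hr0 hr2
  rw [neg_sq] at hr2
  rw [abs_of_pos h0, ← hω] at hl0 hr0 hl2 hr2
  set l := steklov h F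
  set r := steklov (-h) F
  set l₁ := steklov h F₁
  set r₁ := steklov (-h) F₁
  set l₂ := steklov h f
  set r₂ := steklov (-h) f
  have hlc : Continuous fun x => f x - l x := hf.sub hl.continuous
  have hrc : Continuous fun x => f x - r x := hf.sub hr.continuous
  set H := ENNReal.ofReal (h ^ 2) with hH
  have hH1 : H ≤ 1 := ENNReal.ofReal_le_one.2 (by nlinarith)
  -- the size of the difference of the two means, and of its derivative, on the overlap
  set Δ := D * (eLpNorm (fun x => r x - l x) p (volume.restrict (Icc (1 / 4) (3 / 4)))
    + eLpNorm (fun x => r₂ x - l₂ x) p (volume.restrict (Icc (1 / 4) (3 / 4)))) with hΔ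
  have hmid : Icc (1 / 4 : ℝ) (3 / 4) ⊆ Icc 0 (3 / 4) := Icc_subset_Icc_left (by norm_num)
  have hmid' : Icc (1 / 4 : ℝ) (3 / 4) ⊆ Icc (1 / 4) 1 := Icc_subset_Icc_right (by norm_num)
  have hmid1 : Icc (1 / 4 : ℝ) (3 / 4) ⊆ Icc 0 1 := Icc_subset_Icc (by norm_num) (by norm_num)
  have hHΔ : H * Δ ≤ D * 8 * ω := by
    have h1 : eLpNorm (fun x => r x - l x) p (volume.restrict (Icc (1 / 4) (3 / 4))) ≤ ω + ω := by
      have e : (fun x => r x - l x) = (fun x => f x - l x) - fun x => f x - r x := by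
        ext x; simp
      rw [e]
      refine (eLpNorm_sub_le hlc.aestronglyMeasurable hrc.aestronglyMeasurable hp).trans ?_
      exact add_le_add
        ((eLpNorm_mono_measure _ (Measure.restrict_mono hmid le_rfl)).trans hl0)
        ((eLpNorm_mono_measure _ (Measure.restrict_mono hmid' le_rfl)).trans hr0)
    have h2 : H * eLpNorm (fun x => r₂ x - l₂ x) p (volume.restrict (Icc (1 / 4) (3 / 4)))
        ≤ 3 * ω + 3 * ω := by
      refine (mul_le_mul' le_rfl (eLpNorm_sub_le hr.continuous_snd.aestronglyMeasurable
        hl.continuous_snd.aestronglyMeasurable hp)).trans ?_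
      rw [mul_add]
      refine add_le_add ((mul_le_mul' le_rfl ?_).trans hr2) ((mul_le_mul' le_rfl ?_).trans hl2)
      · exact eLpNorm_mono_measure _ (Measure.restrict_mono hmid' le_rfl)
      · exact eLpNorm_mono_measure _ (Measure.restrict_mono hmid le_rfl)
    calc H * Δ = D * (H * eLpNorm (fun x => r x - l x) p (volume.restrict (Icc (1 / 4) (3 / 4)))
          + H * eLpNorm (fun x => r₂ x - l₂ x) p (volume.restrict (Icc (1 / 4) (3 / 4)))) := by
          rw [hΔ]; ring
      _ ≤ D * (1 * (ω + ω) + (3 * ω + 3 * ω)) := by gcongr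
      _ = D * 8 * ω := by ring
  have hΔtop : Δ ≠ ∞ := by
    have hfin : ∀ u : ℝ → ℝ, Continuous u →
        eLpNorm u p (volume.restrict (Icc (1 / 4) (3 / 4))) ≠ ∞ := fun u hu =>
      ((eLpNorm_mono_measure _ (Measure.restrict_mono hmid1 le_rfl)).trans_lt
        (eLpNorm_ne_top_of_continuous hu).lt_top).ne
    exact ENNReal.mul_ne_top ENNReal.coe_ne_top (ENNReal.add_ne_top.2
      ⟨hfin _ hd.continuous, hfin _ hd.continuous_snd⟩)
  have hdmid : ∀ x ∈ Icc (1 / 4 : ℝ) (3 / 4),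
      |r x - l x| ≤ Δ.toReal ∧ |r₁ x - l₁ x| ≤ Δ.toReal := by
    intro x hx
    have := hD _ _ _ hd x hx
    rw [Real.enorm_eq_ofReal_abs, Real.enorm_eq_ofReal_abs] at this
    exact ⟨(ENNReal.ofReal_le_iff_le_toReal hΔtop).1 this.1,
      (ENNReal.ofReal_le_iff_le_toReal hΔtop).1 this.2⟩
  have hΔ0 : 0 ≤ Δ.toReal := ENNReal.toReal_nonneg
  refine ⟨_, _, _, hl.add (hψ.mul hd), ?_, ?_⟩
  · -- the error is a convex combination of the errors of the two means
    refine (eLpNorm_leb01_le_of_abs_le hp hlc hrc (A := Icc 0 (3 / 4)) (B := Icc (1 / 4) 1)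
      measurableSet_Icc measurableSet_Icc le_rfl ?_).trans ?_
    · intro x hx
      have e : f x - (l x + ψ x * (r x - l x)) = (1 - ψ x) * (f x - l x) + ψ x * (f x - r x) := by
        ring
      rw [e, add_zero]
      refine (abs_add_le _ _).trans (add_le_add ?_ ?_) <;> rw [abs_mul]
      · rw [abs_of_nonneg (by linarith [(hψ01 x).2])]
        by_cases hxl : x ∈ Icc (0 : ℝ) (3 / 4)
        · rw [indicator_of_mem hxl]
          exact mul_le_of_le_one_left (abs_nonneg _) (by linarith [(hψ01 x).1])
        · have : 3 / 4 ≤ x := by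
            by_contra hcon
            exact hxl ⟨hx.1, (not_le.1 hcon).le⟩
          rw [indicator_of_notMem hxl, (hψr x this).1]
          simp
      · rw [abs_of_nonneg (hψ01 x).1]
        by_cases hxr : x ∈ Icc (1 / 4 : ℝ) 1
        · rw [indicator_of_mem hxr]
          exact mul_le_of_le_one_left (abs_nonneg _) (hψ01 x).2
        · have : x ≤ 1 / 4 := by
            by_contra hcon
            exact hxr ⟨(not_le.1 hcon).le, hx.2⟩
          rw [indicator_of_notMem hxr, (hψl x this).1]
          simp
    · calc _ ≤ ω + ω + ENNReal.ofReal 0 := by gcongr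
        _ = 2 * ω := by rw [ENNReal.ofReal_zero]; ring
        _ ≤ _ := by
          gcongr
          push_cast
          exact le_add_right (by norm_num)
  · refine (mul_le_mul' le_rfl (eLpNorm_leb01_le_of_abs_le hp hl.continuous_snd hr.continuous_snd
      (A := Icc 0 (3 / 4)) (B := Icc (1 / 4) 1) measurableSet_Icc measurableSet_Icc
      (c := 3 * K * Δ.toReal) (by positivity) ?_)).trans ?_
    · intro x hx
      have e : l₂ x + (ψ₂ x * (r x - l x) + 2 * (ψ₁ x * (r₁ x - l₁ x)) + ψ x * (r₂ x - l₂ x))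
          = (1 - ψ x) * l₂ x + ψ x * r₂ x
            + (ψ₂ x * (r x - l x) + 2 * (ψ₁ x * (r₁ x - l₁ x))) := by ring
      rw [e]
      refine (abs_add_le _ _).trans (add_le_add ((abs_add_le _ _).trans (add_le_add ?_ ?_)) ?_)
      · rw [abs_mul, abs_of_nonneg (by linarith [(hψ01 x).2])]
        by_cases hxl : x ∈ Icc (0 : ℝ) (3 / 4)
        · rw [indicator_of_mem hxl]
          exact mul_le_of_le_one_left (abs_nonneg _) (by linarith [(hψ01 x).1])
        · have : 3 / 4 ≤ x := by
            by_contra hcon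
            exact hxl ⟨hx.1, (not_le.1 hcon).le⟩
          rw [indicator_of_notMem hxl, (hψr x this).1]
          simp
      · rw [abs_mul, abs_of_nonneg (hψ01 x).1]
        by_cases hxr : x ∈ Icc (1 / 4 : ℝ) 1
        · rw [indicator_of_mem hxr]
          exact mul_le_of_le_one_left (abs_nonneg _) (hψ01 x).2
        · have : x ≤ 1 / 4 := by
            by_contra hcon
            exact hxr ⟨(not_le.1 hcon).le, hx.2⟩
          rw [indicator_of_notMem hxr, (hψl x this).1]
          simp
      · by_cases hxm : x ∈ Icc (1 / 4 : ℝ) (3 / 4)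
        · obtain ⟨h1, h2⟩ := hdmid x hxm
          obtain ⟨h3, h4⟩ := hK x hx
          have h5 : |ψ₂ x * (r x - l x)| ≤ K * Δ.toReal := by
            rw [abs_mul]; gcongr
          have h6 : |2 * (ψ₁ x * (r₁ x - l₁ x))| ≤ 2 * (K * Δ.toReal) := by
            rw [abs_mul, abs_mul, abs_two]; gcongr
          refine (abs_add_le _ _).trans ?_
          linarith
        · have h12 : ψ₁ x = 0 ∧ ψ₂ x = 0 := by
            rcases le_total x (1 / 4) with h1 | h1
            · exact (hψl x h1).2
            · refine (hψr x ?_).2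
              by_contra hcon
              exact hxm ⟨h1, (not_le.1 hcon).le⟩
          rw [h12.1, h12.2]
          simp only [zero_mul, mul_zero, add_zero, abs_zero]
          positivity
    · have e : ENNReal.ofReal (3 * K * Δ.toReal) = 3 * (K.toNNReal : ℝ≥0∞) * Δ := by
        rw [ENNReal.ofReal_mul (by positivity), ENNReal.ofReal_toReal hΔtop,
          ENNReal.ofReal_mul (by norm_num), ENNReal.ofReal_ofNat]
        rfl
      rw [e]
      calc _ = H * eLpNorm l₂ p (volume.restrict (Icc 0 (3 / 4)))
            + H * eLpNorm r₂ p (volume.restrict (Icc (1 / 4) 1))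
            + 3 * K.toNNReal * (H * Δ) := by ring
        _ ≤ 3 * ω + 3 * ω + 3 * K.toNNReal * (D * 8 * ω) := by gcongr
        _ = _ := by push_cast; ring

/-! ### The modulus of smoothness under `L_p` perturbations -/

theorem eLpNorm_comp_add_right_le {p : ℝ≥0∞} {w : ℝ → ℝ} (hw : StronglyMeasurable w) {S : Set ℝ}
    {c : ℝ} (hS : ∀ x ∈ S, x + c ∈ Icc (0 : ℝ) 1) :
    eLpNorm (fun x => w (x + c)) p (volume.restrict S) ≤ eLpNorm w p leb01 := by
  have hmp := (measurePreserving_add_right (volume : Measure ℝ) c).restrict_preimage_emb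
    (measurableEmbedding_addRight c) (Icc 0 1)
  rw [← eLpNorm_comp_measurePreserving hw.aestronglyMeasurable hmp]
  exact eLpNorm_mono_measure _ (Measure.restrict_mono hS le_rfl)

theorem eLpNorm_rDiff_two_le {p : ℝ≥0∞} (hp : 1 ≤ p) {w : ℝ → ℝ} (hw : StronglyMeasurable w)
    {S : Set ℝ} {h : ℝ} (hS : ∀ x ∈ S, x ∈ Icc (0 : ℝ) 1 ∧ x + 2 * h ∈ Icc (0 : ℝ) 1) :
    eLpNorm (rDiff 2 h w) p (volume.restrict S) ≤ 4 * eLpNorm w p leb01 := by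
  have hm : ∀ c : ℝ, AEStronglyMeasurable (fun x => w (x + c)) (volume.restrict S) := fun c =>
    (hw.comp_measurable (measurable_add_const c)).aestronglyMeasurable
  have h0 : eLpNorm w p (volume.restrict S) ≤ eLpNorm w p leb01 :=
    eLpNorm_mono_measure _ (Measure.restrict_mono (fun x hx => (hS x hx).1) le_rfl)
  have h2 := eLpNorm_comp_add_right_le (p := p) hw (S := S) (c := 2 * h) fun x hx => (hS x hx).2
  have h1 := eLpNorm_comp_add_right_le (p := p) hw (S := S) (c := h) fun x hx => by
    have hconv := (convex_Icc (𝕜 := ℝ) (0 : ℝ) 1) (hS x hx).1 (hS x hx).2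
      (a := 1 / 2) (b := 1 / 2) (by norm_num) (by norm_num) (by norm_num)
    convert hconv using 1
    simp only [smul_eq_mul]
    ring
  have e : rDiff 2 h w = ((fun x => w (x + 2 * h)) - fun x => 2 * w (x + h)) + w :=
    funext (rDiff_two h w)
  have e2 : ‖(2 : ℝ)‖ₑ = 2 := by rw [Real.enorm_eq_ofReal (by norm_num)]; norm_num
  rw [e]
  calc _ ≤ eLpNorm (fun x => w (x + 2 * h)) p (volume.restrict S)
        + eLpNorm (fun x => 2 * w (x + h)) p (volume.restrict S)
        + eLpNorm w p (volume.restrict S) :=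
        (eLpNorm_add_le ((hm _).sub ((hm _).const_mul 2)) hw.aestronglyMeasurable hp).trans
          (add_le_add_left (eLpNorm_sub_le (hm _) ((hm _).const_mul 2) hp) _)
    _ ≤ eLpNorm w p leb01 + 2 * eLpNorm w p leb01 + eLpNorm w p leb01 := by
        rw [eLpNorm_const_mul_real, e2]
        gcongr
    _ = _ := by ring

theorem omegaMod_two_le_add {p : ℝ≥0∞} (hp : 1 ≤ p) {f u : ℝ → ℝ} (hf : StronglyMeasurable f)
    (hu : StronglyMeasurable u) (δ : ℝ≥0∞) :
    omegaMod 2 p u δ ≤ omegaMod 2 p f δ + 4 * eLpNorm (f - u) p leb01 := by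
  refine iSup₂_le fun h hδ => ?_
  set S := {x : ℝ | x ∈ Icc (0 : ℝ) 1 ∧ x + ((2 : ℕ) : ℝ) * h ∈ Icc (0 : ℝ) 1} with hSdef
  have hS : ∀ x ∈ S, x ∈ Icc (0 : ℝ) 1 ∧ x + 2 * h ∈ Icc (0 : ℝ) 1 := fun x hx => by
    simpa [hSdef] using hx
  have hm : ∀ v : ℝ → ℝ, StronglyMeasurable v → StronglyMeasurable (rDiff 2 h v) := by
    intro v hv
    have e : rDiff 2 h v = ((fun x => v (x + 2 * h)) - fun x => 2 * v (x + h)) + v :=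
      funext (rDiff_two h v)
    rw [e]
    exact ((hv.comp_measurable (measurable_add_const _)).sub
      ((hv.comp_measurable (measurable_add_const _)).const_mul 2)).add hv
  have e : rDiff 2 h u = rDiff 2 h f - rDiff 2 h (f - u) := by
    ext x
    simp only [rDiff_two, Pi.sub_apply]
    ring
  rw [e]
  refine (eLpNorm_sub_le (hm f hf).aestronglyMeasurable
    (hm _ (hf.sub hu)).aestronglyMeasurable hp).trans (add_le_add ?_ ?_)
  · exact eLpNorm_rDiff_two_le_omegaMod f hδ hS
  · exact eLpNorm_rDiff_two_le hp (hf.sub hu) hS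

/-! ### The approximation theorem -/

theorem enorm_contLp (p : ℝ≥0∞) {u : ℝ → ℝ} (hu : Continuous u) :
    ‖contLp p u hu‖ₑ = eLpNorm u p leb01 := by
  rw [Lp.enorm_def, eLpNorm_congr_ae (coeFn_contLp p hu)]

theorem enorm_sub_contLp (p : ℝ≥0∞) (f : Lp01 p) {u : ℝ → ℝ} (hu : Continuous u) :
    ‖f - contLp p u hu‖ₑ = eLpNorm ((f : ℝ → ℝ) - u) p leb01 := by
  rw [Lp.enorm_def]
  refine eLpNorm_congr_ae ((Lp.coeFn_sub _ _).trans ?_)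
  exact EventuallyEq.rfl.sub (coeFn_contLp p hu)

theorem enorm_contLp_sub_contLp (p : ℝ≥0∞) {u v : ℝ → ℝ} (hu : Continuous u) (hv : Continuous v) :
    ‖contLp p u hu - contLp p v hv‖ₑ = eLpNorm (fun x => u x - v x) p leb01 := by
  rw [enorm_sub_contLp]
  exact eLpNorm_congr_ae ((coeFn_contLp p hu).sub EventuallyEq.rfl)

/-- The error of `T` is Lipschitz in `f`, which allows to replace `f` by a better function. -/
theorem IsSublinearOp.enorm_sub_le {p : ℝ≥0∞} [Fact (1 ≤ p)] {T : Lp01 p → Lp01 p}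
    (hT : IsSublinearOp T) (hm : Monotone T) {R : ℝ≥0} (hR : ∀ f, ‖T f‖ ≤ R * ‖f‖)
    (f g : Lp01 p) : ‖T f - f‖ₑ ≤ (R + 1) * ‖f - g‖ₑ + ‖T g - g‖ₑ := by
  have h1 : ‖T f - T g‖ₑ ≤ R * ‖f - g‖ₑ := by
    rw [← ofReal_norm, ← ofReal_norm, ← ENNReal.ofReal_coe_nnreal,
      ← ENNReal.ofReal_mul R.coe_nonneg]
    exact ENNReal.ofReal_le_ofReal (hT.norm_sub_le hm hR f g)
  have e : T f - f = (T f - T g) + ((T g - g) + (g - f)) := by abel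
  calc ‖T f - f‖ₑ ≤ ‖T f - T g‖ₑ + (‖T g - g‖ₑ + ‖g - f‖ₑ) := by
        rw [e]
        exact (enorm_add_le _ _).trans (add_le_add_right (enorm_add_le _ _) _)
    _ ≤ R * ‖f - g‖ₑ + (‖T g - g‖ₑ + ‖f - g‖ₑ) := by
        rw [← enorm_neg (g - f), neg_sub]
        gcongr
    _ = _ := by ring

theorem hasC2Derivs_polynomial (P : Polynomial ℝ) :
    HasC2Derivs (fun x => P.eval x) (fun x => P.derivative.eval x)
      (fun x => P.derivative.derivative.eval x) :=
  ⟨fun x => P.hasDerivAt x, fun x => P.derivative.hasDerivAt x, Polynomial.continuous _⟩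

/-- If `t_{n,p}` vanishes, the operator fixes all `C²` functions, hence all continuous ones. -/
theorem op_contLp_eq_of_tParam_eq_zero {p : ℝ≥0∞} (hp : 1 < p) (hp' : p < ∞)
    {T : Lp01 p → Lp01 p} (hT : IsSublinearOp T) (hm : Monotone T)
    (htr : IsStronglyTranslatable T) {R : ℝ≥0} (hR : ∀ f, ‖T f‖ ≤ R * ‖f‖) (h0 : tParam T = 0)
    {u : ℝ → ℝ} (hu : Continuous u) : ‖T (contLp p u hu) - contLp p u hu‖ₑ = 0 := by
  have : Fact (1 ≤ p) := ⟨hp.le⟩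
  obtain ⟨C, hC⟩ := exists_enorm_op_contLp_sub_le hp hp'
  refine le_antisymm (ENNReal.le_of_forall_pos_le_add fun ε hε _ => ?_) zero_le
  obtain ⟨P, hP⟩ := exists_polynomial_near_of_continuousOn 0 1 u hu.continuousOn (ε / (R + 1))
    (by positivity)
  have hPC := hasC2Derivs_polynomial P
  have h1 := hT.enorm_sub_le hm hR (contLp p u hu) (contLp p _ hPC.continuous)
  have h2 := hC T hT hm htr (by simp [h0]) _ _ _ hPC
  rw [h0] at h2
  have h3 : ‖T (contLp p _ hPC.continuous) - contLp p _ hPC.continuous‖ₑ = 0 := by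
    simpa using h2
  have h4 : ‖contLp p u hu - contLp p _ hPC.continuous‖ₑ ≤ ENNReal.ofReal (ε / (R + 1)) := by
    rw [enorm_contLp_sub_contLp]
    refine (eLpNorm_le_of_ae_bound (C := ε / (R + 1)) ?_).trans (by simp)
    filter_upwards [ae_restrict_mem measurableSet_Icc] with x hx
    rw [Real.norm_eq_abs, abs_sub_comm]
    exact (hP x hx).le
  rw [h3, add_zero] at h1
  rw [zero_add]
  calc _ ≤ (R + 1 : ℝ≥0∞) * ENNReal.ofReal (ε / (R + 1)) := h1.trans (by gcongr)
    _ = ENNReal.ofReal ((R + 1) * (ε / (R + 1))) := by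
        rw [ENNReal.ofReal_mul (by positivity), ENNReal.ofReal_add (by positivity) (by positivity)]
        simp
    _ = ε := by
        rw [mul_div_cancel₀ _ (by positivity)]
        simp

/-- The estimate for continuous functions and `t_{n,p} ≤ 1 / 8`, where the Steklov means of step
`t_{n,p} / 2` fit into `[0,1]`. -/
theorem exists_enorm_op_contLp_sub_le_omegaMod {p : ℝ≥0∞} (hp : 1 < p) (hp' : p < ∞) (R : ℝ≥0) :
    ∃ C : ℝ≥0, ∀ T : Lp01 p → Lp01 p, IsSublinearOp T → Monotone T → IsStronglyTranslatable T →
      (∀ f, ‖T f‖ ≤ R * ‖f‖) → tParam T ≤ ENNReal.ofReal (1 / 8) →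
      ∀ (u : ℝ → ℝ) (hu : Continuous u), ‖T (contLp p u hu) - contLp p u hu‖ₑ
        ≤ C * (tParam T ^ 2 * eLpNorm u p leb01 + omegaMod 2 p u (tParam T)) := by
  have : Fact (1 ≤ p) := ⟨hp.le⟩
  obtain ⟨C, hC⟩ := exists_enorm_op_contLp_sub_le hp hp'
  obtain ⟨K, hK⟩ := exists_hasC2Derivs_approx hp.le hp'.ne
  refine ⟨(R + 1) * K + C * (1 + 5 * K), fun T hT hm htr hR ht8 u hu => ?_⟩
  rcases eq_or_ne (tParam T) 0 with h0 | h0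
  · rw [op_contLp_eq_of_tParam_eq_zero hp hp' hT hm htr hR h0 hu]
    exact zero_le
  have htop : tParam T ≠ ∞ := (ht8.trans_lt ENNReal.ofReal_lt_top).ne
  obtain ⟨t, ht⟩ : ∃ t, t = (tParam T).toReal := ⟨_, rfl⟩
  have hof : tParam T = ENNReal.ofReal t := by rw [ht, ENNReal.ofReal_toReal htop]
  have ht0 : 0 < t := ht ▸ ENNReal.toReal_pos h0 htop
  have ht1 : t ≤ 1 / 8 := by
    rw [hof] at ht8; exact (ENNReal.ofReal_le_ofReal_iff (by norm_num)).1 ht8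
  obtain ⟨g, g₁, g₂, hg, hg0, hg2⟩ := hK u hu (t / 2) (by linarith) (by linarith)
  have e2 : 2 * (t / 2) = t := by ring
  rw [e2, ← hof] at hg0 hg2
  set ω := omegaMod 2 p u (tParam T)
  set τ := tParam T ^ 2 with hτ
  have hτ1 : τ ≤ 1 := by
    rw [hτ, hof, ← ENNReal.ofReal_pow ht0.le]
    exact ENNReal.ofReal_le_one.2 (by nlinarith)
  have hτ2 : τ = 4 * ENNReal.ofReal ((t / 2) ^ 2) := by
    rw [hτ, hof, ← ENNReal.ofReal_pow ht0.le, ← ENNReal.ofReal_ofNat,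
      ← ENNReal.ofReal_mul (by norm_num)]
    congr 1; ring
  have h1 := hT.enorm_sub_le hm hR (contLp p u hu) (contLp p _ hg.continuous)
  have h2 := hC T hT hm htr htop _ _ _ hg
  rw [enorm_contLp_sub_contLp] at h1
  have h3 : eLpNorm g p leb01 ≤ eLpNorm u p leb01 + K * ω := by
    have e : g = u - fun x => u x - g x := by ext x; simp
    calc eLpNorm g p leb01 = eLpNorm (u - fun x => u x - g x) p leb01 := by rw [← e]
      _ ≤ eLpNorm u p leb01 + eLpNorm (fun x => u x - g x) p leb01 :=
          eLpNorm_sub_le hu.aestronglyMeasurable (hu.sub hg.continuous).aestronglyMeasurable hp.le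
      _ ≤ _ := by gcongr
  have h4 : τ * eLpNorm g₂ p leb01 ≤ 4 * (K * ω) := by
    rw [hτ2, mul_assoc]; gcongr
  calc ‖T (contLp p u hu) - contLp p u hu‖ₑ
      ≤ (R + 1) * (K * ω) + C * (τ * (eLpNorm u p leb01 + K * ω) + 4 * (K * ω)) := by
        refine h1.trans (add_le_add (by gcongr) (h2.trans ?_))
        rw [mul_add]
        gcongr
    _ = (R + 1) * K * ω + C * (τ * eLpNorm u p leb01 + τ * (K * ω) + 4 * (K * ω)) := by ring
    _ ≤ (R + 1) * K * ω + C * (τ * eLpNorm u p leb01 + 1 * (K * ω) + 4 * (K * ω)) := by gcongr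
    _ = C * (τ * eLpNorm u p leb01) + ((R + 1) * K + C * (5 * K)) * ω := by ring
    _ ≤ C * (τ * eLpNorm u p leb01) + ((R + 1) * K + C * (5 * K)) * ω
          + (((R + 1) * K + C * (5 * K)) * (τ * eLpNorm u p leb01) + C * ω) := le_self_add
    _ = _ := by push_cast; ring

theorem mainTheorem3 (p : ℝ≥0∞) (hp : 1 < p) (hp' : p < ∞)
    (T : ℕ → Lp01 p → Lp01 p)
    (hsub : ∀ n, IsSublinearOp (T n))
    (hmono : ∀ n, Monotone (T n))
    (htrans : ∀ n, IsStronglyTranslatable (T n))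
    (hbdd : ∃ R : ℝ, ∀ (n : ℕ) (f : Lp01 p), ‖T n f‖ ≤ R * ‖f‖)
    (hlim : Tendsto (fun n => tParam (T n)) atTop (𝓝 0)) :
    ∃ M : ℝ≥0, 0 < M ∧ ∀ (n : ℕ) (f : Lp01 p),
      ‖T n f - f‖ₑ ≤ M * (tParam (T n) ^ 2 * ‖f‖ₑ + omegaMod 2 p f (tParam (T n))) := by
  have : Fact (1 ≤ p) := ⟨hp.le⟩
  obtain ⟨R', hR'⟩ := hbdd
  obtain ⟨R, hR⟩ : ∃ R : ℝ≥0, ∀ (n : ℕ) (f : Lp01 p), ‖T n f‖ ≤ R * ‖f‖ :=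
    ⟨R'.toNNReal, fun n f => (hR' n f).trans
      (mul_le_mul_of_nonneg_right (Real.le_coe_toNNReal R') (norm_nonneg f))⟩
  obtain ⟨C, hC⟩ := exists_enorm_op_contLp_sub_le_omegaMod hp hp' R
  refine ⟨64 * (R + 1) + C, by positivity, fun n f => ?_⟩
  set t := tParam (T n)
  rcases lt_or_ge (ENNReal.ofReal (1 / 8)) t with ht | ht
  · -- here `64 * t ^ 2 ≥ 1`, and boundedness of the operators suffices
    have h1 := (hsub n).enorm_sub_le (hmono n) (hR n) f 0
    rw [(hsub n).map_zero, sub_self, enorm_zero, add_zero, sub_zero] at h1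
    have h64 : 1 ≤ 64 * t ^ 2 := by
      calc (1 : ℝ≥0∞) = 64 * ENNReal.ofReal (1 / 8) ^ 2 := by
            rw [← ENNReal.ofReal_pow (by norm_num), ← ENNReal.ofReal_ofNat,
              ← ENNReal.ofReal_mul (by norm_num)]
            norm_num
        _ ≤ 64 * t ^ 2 := by gcongr
    calc ‖T n f - f‖ₑ ≤ 1 * ((R + 1) * ‖f‖ₑ) := by rwa [one_mul]
      _ ≤ 64 * t ^ 2 * ((R + 1) * ‖f‖ₑ) := by gcongr
      _ = 64 * (R + 1) * (t ^ 2 * ‖f‖ₑ) := by ring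
      _ ≤ _ := by
        push_cast
        exact mul_le_mul' le_self_add le_self_add
  · have ht1 : t ^ 2 ≤ 1 :=
      pow_le_one₀ zero_le (ht.trans (ENNReal.ofReal_le_one.2 (by norm_num)))
    set ω := omegaMod 2 p f t
    suffices h : ‖T n f - f‖ₑ ≤ C * (t ^ 2 * ‖f‖ₑ + ω) from
      h.trans (mul_le_mul' (by push_cast; exact le_add_self) le_rfl)
    refine ENNReal.le_of_forall_pos_le_add fun ε hε _ => ?_
    -- the accuracy of a continuous approximation that costs at most `ε` in the final estimate
    set η : ℝ≥0 := ε / (R + 1 + 5 * C) with hη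
    have hη0 : (η : ℝ≥0∞) ≠ 0 := by
      rw [ENNReal.coe_ne_zero, hη]; positivity
    obtain ⟨v, hv, -⟩ := (Lp.memLp f).exists_boundedContinuous_eLpNorm_sub_le hp'.ne hη0
    have hvc : Continuous v := v.continuous
    have h1 := (hsub n).enorm_sub_le (hmono n) (hR n) f (contLp p v hvc)
    have h2 := hC (T n) (hsub n) (hmono n) (htrans n) (hR n) ht v hvc
    have h3 : ‖f - contLp p v hvc‖ₑ ≤ η := by rwa [enorm_sub_contLp]
    have h4 : eLpNorm v p leb01 ≤ ‖f‖ₑ + η := by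
      have e : contLp p v hvc = f - (f - contLp p v hvc) := by abel
      rw [← enorm_contLp p hvc, e]
      exact (enorm_sub_le).trans (add_le_add_right h3 _)
    have h5 : omegaMod 2 p v t ≤ ω + 4 * η :=
      (omegaMod_two_le_add hp.le (Lp.stronglyMeasurable f) hvc.stronglyMeasurable t).trans
        (by gcongr)
    calc ‖T n f - f‖ₑ ≤ (R + 1) * η + C * (t ^ 2 * (‖f‖ₑ + η) + (ω + 4 * η)) := by
          refine h1.trans (add_le_add (by gcongr) (h2.trans ?_))
          gcongr
      _ = (R + 1) * η + C * (t ^ 2 * ‖f‖ₑ + t ^ 2 * η + ω + 4 * η) := by ring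
      _ ≤ (R + 1) * η + C * (t ^ 2 * ‖f‖ₑ + 1 * η + ω + 4 * η) := by gcongr
      _ = C * (t ^ 2 * ‖f‖ₑ + ω) + ((R + 1 + 5 * C : ℝ≥0) : ℝ≥0∞) * η := by push_cast; ring
      _ = _ := by
          congr 1
          rw [← ENNReal.coe_mul, hη, mul_div_cancel₀ _ (by positivity)]
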